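/- Let $n\ge 1$, let $\mathbb H^{n,1}$ be the right quaternionic vector space $\mathbb H^{n+1}$ with the Hermitian form $\langle z,w\rangle=\bar w_{n+1}z_1+\bar w_2z_2+\dots+\bar w_nz_n+\bar w_1z_{n+1}$, let $\mathrm{Sp}(n,1)$ be its isometry group, and let $\overline{\mathbf H}$ be the set of right lines spanned by negative or null vectors. Let $\mathfrak X_{ss}(F_2,\mathrm{Sp}(n,1))$ be the set of conjugacy classes of representations $\rho$ of the free group $F_2=\langle x,y\rangle$ into $\mathrm{Sp}(n,1)$ with $\rho(x)$, $\rho(y)$ semisimple. The data attached to such a $\rho$, with $A=\rho(x)$, $B=\rho(y)$, are the following. (1) The real traces $\mathrm{tr}_{\mathbb R}(A)$, $\mathrm{tr}_{\mathbb R}(B)$. The real trace of $g$ is the collection of coefficients of the characteristic polynomial of the complex $(2n+2)\times(2n+2)$ matrix $g_{\mathbb C}$ of $g$. (2) The negative-type eigenvalue classes of $A$ and of $B$: the similarity classes $[\lambda]$ for which there is $v$ with $\langle v,v\rangle<0$ and $Av=v\lambda$ (respectively $Bv=v\lambda$). There is exactly one if the element is elliptic and none if it is hyperbolic. (3) The canonical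 orbit of $(A,B)$. A semisimple element $g$ is hyperbolic or elliptic. It has an orthonormal eigenframe, a basis of eigenvectors whose eigenvalues are complex numbers with imaginary part $\ge 0$. If $g$ is hyperbolic the frame is $(a,x_1,\dots,x_{n-1},r)$ with $a,r$ null, $\langle a,r\rangle=1$, $\langle x_i,x_j\rangle=\delta_{ij}$, $a,r\perp x_i$, and the eigenvalue of $a$ of modulus $>1$. If $g$ is elliptic the frame is $(x_1,\dots,x_{n+1})$, orthogonal, with $\langle x_1,x_1\rangle=-1$ and $\langle x_j,x_j\rangle=1$ for $j\ge 2$. The eigenvalues at the $x_i$ (with $i\ge2$ in the elliptic case) are listed by increasing argument. The group $G_g$ of all block-diagonal matrices that preserve the Gram matrix of the frame, with one block for each eigenvalue in the list, acts on frames from the right. The associated points of a frame are the points of $\overline{\mathbf H}$ spanned by $a$, $r$, $(a-r)/\sqrt2+x_i$ if $g$ is hyperbolic, and by $x_1$, $\sqrt2\,x_1+x_j$ ($j\ge2$) if $g$ is elliptic. The canonical orbit of $(A,B)$, a point of $\mathcal{QL}_n$, is the set of $\mathrm{Sp}(n,1)$-congruence classes of the $(2n+2)$-tuples of associated points of all pairs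 of frames in the $G_A\times G_B$-orbit of eigenframes of $A$ and $B$; if $A$ and $B$ are both hyperbolic, only pairs with $\langle r_A,a_B\rangle=1$ are used, unless $r_A$ and $a_B$ span the same point. (4) A point on each eigenvalue Grassmannian of $A$ and $B$. For a non-real eigenvalue class $[\lambda]$ of $g$, represented by $\lambda\in\mathbb C$ with positive imaginary part, and of multiplicity $m$, the eigenvalue Grassmannian is the set of complex $m$-dimensional subspaces of the eigenspace of $[\lambda]$ (the quaternionic span of the $\lambda$-eigenvectors, of complex dimension $2m$). The point given by $g$ is the eigenset $S_\lambda(g)=\{v: gv=v\lambda\}$. **Statement.** Two such representations $\rho,\sigma$ define the same element of $\mathfrak X_{ss}(F_2,\mathrm{Sp}(n,1))$ if and only if $\rho(x)$ and $\sigma(x)$ have the same real trace and the same negative-type classes, likewise $\rho(y)$ and $\sigma(y)$, the canonical orbits of $(\rho(x),\rho(y))$ and $(\sigma(x),\sigma(y))$ are equal, and they define the same points on the eigenvalue Grassmannians. The last condition means: there is $C\in\mathrm{Sp}(n,1)$ that realizes the equality of the canonical orbits, i.e. carries a tuple of associated points of $(\rho(x),\rho(y))$ to one of $(\sigma(x),\sigma(y))$,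 and that carries $S_\lambda(\rho(x))$ to $S_\lambda(\sigma(x))$ and $S_\lambda(\rho(y))$ to $S_\lambda(\sigma(y))$ for all non-real classes $[\lambda]$. -/

import Mathlib

open scoped Quaternion Matrix MulOpposite LinearAlgebra.Projectivization

noncomputable section

namespace QHyp

/-! ## The Hermitian space `ℍ^{n,1}`, the group `Sp(n,1)` and quaternionic hyperbolic space -/

/-- Column vectors with `n+1` quaternionic entries; a right `ℍ`-vector space, that is, a module
over `ℍᵐᵒᵖ`, with `MulOpposite.op q • v` the vector `v q`. -/
abbrev Vec (n : ℕ) : Type := Fin (n + 1) → ℍ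

/-- Quaternionic matrices of size `n+1`. -/
abbrev Mat (n : ℕ) : Type := Matrix (Fin (n + 1)) (Fin (n + 1)) ℍ

/-- The matrix of the Hermitian form in the Siegel model: the identity matrix with its first and
last columns exchanged. -/
def siegel (n : ℕ) : Mat n :=
  Matrix.of fun i j => if Equiv.swap 0 (Fin.last n) i = j then 1 else 0

/-- The Hermitian form `⟨z, w⟩ = w* H z` of signature `(n,1)`. -/
def herm {n : ℕ} (z w : Vec n) : ℍ := star w ⬝ᵥ (siegel n *ᵥ z)

/-- The group `Sp(n,1)` of all invertible quaternionic matrices that preserve the form. -/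
def Sp (n : ℕ) : Subgroup (Mat n)ˣ where
  carrier := {g | (g : Mat n)ᴴ * siegel n * (g : Mat n) = siegel n}
  one_mem' := by simp
  mul_mem' := by
    intro a b ha hb
    simp only [Set.mem_ofPred_eq, Units.val_mul, Matrix.conjTranspose_mul] at ha hb ⊢
    calc (b : Mat n)ᴴ * (a : Mat n)ᴴ * siegel n * ((a : Mat n) * (b : Mat n))
        = (b : Mat n)ᴴ * ((a : Mat n)ᴴ * siegel n * (a : Mat n)) * (b : Mat n) := by
          simp only [Matrix.mul_assoc]
      _ = siegel n := by rw [ha, hb]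
  inv_mem' := by
    intro a ha
    simp only [Set.mem_ofPred_eq] at ha ⊢
    have h1 : (a : Mat n) * ((a⁻¹ : (Mat n)ˣ) : Mat n) = 1 := Units.mul_inv a
    have h2 : ((a⁻¹ : (Mat n)ˣ) : Mat n)ᴴ * (a : Mat n)ᴴ = 1 := by
      rw [← Matrix.conjTranspose_mul, h1, Matrix.conjTranspose_one]
    calc ((a⁻¹ : (Mat n)ˣ) : Mat n)ᴴ * siegel n * ((a⁻¹ : (Mat n)ˣ) : Mat n)
        = ((a⁻¹ : (Mat n)ˣ) : Mat n)ᴴ * ((a : Mat n)ᴴ * siegel n * (a : Mat n))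
            * ((a⁻¹ : (Mat n)ˣ) : Mat n) := by rw [ha]
      _ = (((a⁻¹ : (Mat n)ˣ) : Mat n)ᴴ * (a : Mat n)ᴴ) * siegel n
            * ((a : Mat n) * ((a⁻¹ : (Mat n)ˣ) : Mat n)) := by simp only [Matrix.mul_assoc]
      _ = siegel n := by rw [h1, h2, Matrix.one_mul, Matrix.mul_one]

/-- The matrix of an element of `Sp(n,1)`. -/
def mat {n : ℕ} (g : Sp n) : Mat n := ((g : (Mat n)ˣ) : Mat n)

/-- The quaternionic projective space of right lines in `ℍ^{n,1}`; it carries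
the projective action of `Sp(n,1)`, which is the action of `PSp(n,1)`. -/
abbrev HP (n : ℕ) : Type := ℙ ℍᵐᵒᵖ (Vec n)

/-- The line `p` is spanned by a negative or null vector. -/
def IsNonpositive {n : ℕ} (p : HP n) : Prop := (herm p.rep p.rep).re ≤ 0

/-- Quaternionic hyperbolic space together with its ideal boundary: the lines spanned by negative
and by null vectors. -/
abbrev ClosedHyp (n : ℕ) : Type := {p : HP n // IsNonpositive p}

/-- Two tuples of points are congruent if an element of `Sp(n,1)` carries one to the other. -/
def congruence (n : ℕ) (ι : Type) : Setoid (ι → ClosedHyp n) where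
  r p q := ∃ g : Sp n, ∀ i, g • (p i).1 = (q i).1
  iseqv :=
    { refl := fun p => ⟨1, fun i => one_smul _ _⟩
      symm := by
        rintro p q ⟨g, hg⟩
        exact ⟨g⁻¹, fun i => by rw [← hg i, inv_smul_smul]⟩
      trans := by
        rintro p q r ⟨g, hg⟩ ⟨h, hh⟩
        exact ⟨h * g, fun i => by rw [mul_smul, hg i, hh i]⟩ }

/-- The moduli space of congruence classes of tuples of points of the closure of hyperbolic space.
Points of a tuple may be null or negative, and may coincide; so this is the disjoint union, over
the possible patterns of null points and of coincidences, of the spaces of congruence classes of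
tuples of distinct points with a prescribed pattern. -/
def Moduli (n : ℕ) (ι : Type) : Type := Quotient (congruence n ι)

/-! ## Real traces, semisimple elements, representations of the free group -/

/-- The complex matrix `((A₁, -conj A₂), (A₂, conj A₁))` of size `2n+2` of a quaternionic matrix
`A = A₁ + j A₂` with `A₁`, `A₂` complex. -/
def complexRep {n : ℕ} (A : Mat n) :
    Matrix (Fin (n + 1) ⊕ Fin (n + 1)) (Fin (n + 1) ⊕ Fin (n + 1)) ℂ :=
  let A₁ : Matrix (Fin (n + 1)) (Fin (n + 1)) ℂ := A.map fun a => ⟨a.re, a.imI⟩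
  let A₂ : Matrix (Fin (n + 1)) (Fin (n + 1)) ℂ := A.map fun a => ⟨a.imJ, -a.imK⟩
  Matrix.fromBlocks A₁ (-(A₂.map star)) A₂ (A₁.map star)

/-- The real trace: the collection of the coefficients of the characteristic polynomial of the
complex matrix of `g`. -/
def realTrace {n : ℕ} (g : Sp n) : ℕ → ℂ := fun j => (complexRep (mat g)).charpoly.coeff j

/-- An element of `Sp(n,1)` is semisimple if its complex matrix is a semisimple endomorphism. -/
def IsSemisimple {n : ℕ} (g : Sp n) : Prop :=
  Module.End.IsSemisimple (Matrix.toLin' (complexRep (mat g)))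

/-- The free group `F₂ = ⟨x, y⟩`. -/
abbrev F₂ : Type := FreeGroup (Fin 2)

/-- The generator `x`. -/
abbrev x : F₂ := FreeGroup.of 0

/-- The generator `y`. -/
abbrev y : F₂ := FreeGroup.of 1

/-- Representations of `F₂` in `Sp(n,1)` that send `x` and `y` to semisimple elements. -/
def SSRep (n : ℕ) : Type := {ρ : F₂ →* Sp n // IsSemisimple (ρ x) ∧ IsSemisimple (ρ y)}

/-- Conjugacy of representations. -/
def conjugacy (n : ℕ) : Setoid (SSRep n) where
  r ρ σ := ∃ g : Sp n, ∀ w : F₂, σ.1 w = g * ρ.1 w * g⁻¹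
  iseqv :=
    { refl := fun ρ => ⟨1, fun w => by simp⟩
      symm := by
        rintro ρ σ ⟨g, hg⟩
        exact ⟨g⁻¹, fun w => by rw [hg w]; group⟩
      trans := by
        rintro ρ σ τ ⟨g, hg⟩ ⟨h, hh⟩
        exact ⟨h * g, fun w => by rw [hh w, hg w]; group⟩ }

/-- The space `𝔛_ss(F₂, Sp(n,1))` of conjugacy classes. -/
def Xss (n : ℕ) : Type := Quotient (conjugacy n)

/-- The point of `𝔛_ss(F₂, Sp(n,1))` given by a representation. -/
def SSRep.toXss {n : ℕ} (ρ : SSRep n) : Xss n := Quotient.mk (conjugacy n) ρ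

/-! ## Eigensets and eigenvalue Grassmannians -/

section Grassmannian

/-- `ℂ` acts on column vectors by right multiplication. -/
@[reducible] def rightComplex (n : ℕ) : Module ℂ (Vec n) :=
  Module.compHom (Vec n) (Quaternion.ofComplex.toRingHom.toOpposite
    (fun a b => by
      change ((a : ℂ) : ℍ) * (b : ℍ) = (b : ℍ) * (a : ℍ)
      rw [← Quaternion.coeComplex_mul, mul_comm, Quaternion.coeComplex_mul]))

attribute [local instance] rightComplex

lemma complex_smul_apply {n : ℕ} (z : ℂ) (v : Vec n) (i : Fin (n + 1)) :
    (z • v) i = v i * (z : ℍ) := rfl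

lemma complex_smul_eq {n : ℕ} (z : ℂ) (v : Vec n) :
    z • v = MulOpposite.op (z : ℍ) • v := rfl

/-- Matrices act complex linearly, for right multiplication by `ℂ`. -/
def complexLin {n : ℕ} (A : Mat n) : Vec n →ₗ[ℂ] Vec n where
  toFun v := A *ᵥ v
  map_add' := Matrix.mulVec_add A
  map_smul' z v := Matrix.mulVec_smul A (MulOpposite.op (z : ℍ)) v

/-- The `λ`-eigenset `S_λ = {v | A v = v λ}` of a complex number `λ`, a complex subspace. -/
def eigenset {n : ℕ} (A : Mat n) (l : ℂ) : Submodule ℂ (Vec n) where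
  carrier := {v | A *ᵥ v = l • v}
  add_mem' := by
    intro v w hv hw
    simp only [Set.mem_ofPred_eq] at hv hw ⊢
    rw [Matrix.mulVec_add, hv, hw, smul_add]
  zero_mem' := by simp
  smul_mem' := by
    intro z v hv
    simp only [Set.mem_ofPred_eq] at hv ⊢
    have := (complexLin A).map_smul z v
    change A *ᵥ (z • v) = z • (A *ᵥ v) at this
    rw [this, hv, smul_comm]

/-- The eigenspace of the similarity class `[λ]`: the right `ℍ`-span of the eigenvectors. -/
def classEigenspace {n : ℕ} (A : Mat n) (l : ℂ) : Submodule ℍᵐᵒᵖ (Vec n) :=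
  Submodule.span ℍᵐᵒᵖ (eigenset A l : Set (Vec n))

/-- The multiplicity `m` of the class `[λ]`: the quaternionic dimension of its eigenspace. -/
def multiplicity {n : ℕ} (A : Mat n) (l : ℂ) : ℕ := Module.finrank ℍᵐᵒᵖ (classEigenspace A l)

/-- The eigenvalue Grassmannian of the class `[λ]`, `λ` not real: the `m`-dimensional complex
subspaces of the eigenspace of `[λ]`, which is a complex vector space of dimension `2m`. -/
def EigenvalueGrassmannian {n : ℕ} (A : Mat n) (l : ℂ) : Type :=
  {W : Submodule ℂ (Vec n) //
    (W : Set (Vec n)) ⊆ (classEigenspace A l : Set (Vec n)) ∧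
      Module.finrank ℂ W = multiplicity A l}

/-- The quaternion unit `j`. -/
def unitJ : ℍ := ⟨0, 0, 1, 0⟩

lemma unitJ_re : unitJ.re = 0 := rfl

lemma unitJ_imI : unitJ.imI = 0 := rfl

lemma unitJ_imJ : unitJ.imJ = 1 := rfl

lemma unitJ_imK : unitJ.imK = 0 := rfl

lemma quaternion_split (q : ℍ) :
    ∃ z w : ℂ, q = (z : ℍ) + (w : ℍ) * unitJ :=
  ⟨⟨q.re, q.imI⟩, ⟨q.imJ, q.imK⟩, by ext <;> simp [unitJ_re, unitJ_imI, unitJ_imJ, unitJ_imK]⟩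

lemma eigenset_split {n : ℕ} {A : Mat n} {l : ℂ} (hl : l.im ≠ 0) {v w : Vec n}
    (hv : v ∈ eigenset A l) (hw : w ∈ eigenset A l)
    (h : v + MulOpposite.op unitJ • w = 0) : v = 0 ∧ w = 0 := by
  have hv' : A *ᵥ v = l • v := hv
  have hw' : A *ᵥ w = l • w := hw
  have h1 : A *ᵥ (v + MulOpposite.op unitJ • w) = 0 := by rw [h]; simp
  rw [Matrix.mulVec_add, Matrix.mulVec_smul, hv', hw'] at h1
  have hw0 : w = 0 := by
    funext i
    have e1 := congrFun h1 i
    have e2 := congrFun h i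
    simp only [Pi.add_apply, Pi.smul_apply, complex_smul_apply, MulOpposite.smul_eq_mul_unop, MulOpposite.unop_op,
      Pi.zero_apply] at e1 e2
    rw [Quaternion.ext_iff] at e1 e2
    simp [unitJ_re, unitJ_imI, unitJ_imJ, unitJ_imK] at e1 e2
    obtain ⟨a1, a2, a3, a4⟩ := e1
    obtain ⟨b1, b2, b3, b4⟩ := e2
    rw [Quaternion.ext_iff]
    simp
    refine ⟨?_, ?_, ?_, ?_⟩ <;> apply mul_left_cancel₀ hl <;> grind
  subst hw0
  exact ⟨by simpa using h, rfl⟩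

/-- Vectors of an eigenset that are independent over `ℂ` are independent over `ℍ`. -/
lemma eigenset_independent {n : ℕ} {A : Mat n} {l : ℂ} (hl : l.im ≠ 0) {ι : Type*}
    (b : ι → eigenset A l) (hb : LinearIndependent ℂ b) :
    LinearIndependent ℍᵐᵒᵖ (fun i => (b i : Vec n)) := by
  rw [linearIndependent_iff'] at hb ⊢
  intro s g hg i hi
  choose z w hzw using fun i => quaternion_split (g i).unop
  have key : ((∑ i ∈ s, z i • b i : eigenset A l) : Vec n)
      + MulOpposite.op unitJ • ((∑ i ∈ s, w i • b i : eigenset A l) : Vec n) = 0 := by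
    rw [← hg]
    push_cast
    rw [Finset.smul_sum, ← Finset.sum_add_distrib]
    refine Finset.sum_congr rfl fun i _ => ?_
    rw [complex_smul_eq, complex_smul_eq, smul_smul, ← add_smul, ← MulOpposite.op_mul,
      ← MulOpposite.op_add, ← hzw i, MulOpposite.op_unop]
  obtain ⟨h1, h2⟩ := eigenset_split hl (Subtype.property _) (Subtype.property _) key
  have hz := hb s z (Subtype.ext h1) i hi
  have hw := hb s w (Subtype.ext h2) i hi
  have := hzw i
  rw [hz, hw] at this
  apply MulOpposite.unop_injective
  rw [this]
  simp

lemma finrank_eigenset {n : ℕ} (A : Mat n) {l : ℂ} (hl : l.im ≠ 0) :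
    Module.finrank ℂ (eigenset A l) = multiplicity A l := by
  let b := Module.Basis.ofVectorSpace ℂ (eigenset A l)
  have hi := eigenset_independent hl b b.linearIndependent
  have hs : Submodule.span ℍᵐᵒᵖ (Set.range fun i => (b i : Vec n)) = classEigenspace A l := by
    apply le_antisymm
    · apply Submodule.span_mono
      rintro _ ⟨i, rfl⟩
      exact (b i).2
    · apply Submodule.span_le.2
      intro v hv
      have hv' : (⟨v, hv⟩ : eigenset A l) ∈ Submodule.span ℂ (Set.range b) := by
        rw [b.span_eq]; trivial
      have : ∀ u : eigenset A l, u ∈ Submodule.span ℂ (Set.range b) →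
          (u : Vec n) ∈ Submodule.span ℍᵐᵒᵖ (Set.range fun i => (b i : Vec n)) := by
        intro u hu
        induction hu using Submodule.span_induction with
        | mem u hu => obtain ⟨i, rfl⟩ := hu; exact Submodule.subset_span ⟨i, rfl⟩
        | zero => exact Submodule.zero_mem _
        | add u v _ _ hu hv => exact Submodule.add_mem _ hu hv
        | smul z u _ hu => exact Submodule.smul_mem _ (MulOpposite.op (z : ℍ)) hu
      exact this _ hv'
  rw [multiplicity, ← hs, Module.finrank_eq_nat_card_basis b,
    Module.finrank_eq_nat_card_basis (Module.Basis.span hi)]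

/-- The point of the `[λ]`-eigenvalue Grassmannian of `A` that is given by `A`: its eigenset. -/
def eigenPoint {n : ℕ} (A : Mat n) (l : ℂ) (hl : l.im ≠ 0) : EigenvalueGrassmannian A l :=
  ⟨eigenset A l, Submodule.subset_span, finrank_eigenset A hl⟩

/-- `C` carries the point `W` of an eigenvalue Grassmannian of `A` to the point `W'` of the
corresponding eigenvalue Grassmannian of `A'`. -/
def Carries {n : ℕ} (C : Sp n) {A A' : Mat n} {l : ℂ} (W : EigenvalueGrassmannian A l)
    (W' : EigenvalueGrassmannian A' l) : Prop :=
  W.1.map (complexLin (mat C)) = W'.1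

end Grassmannian

/-- The negative classes of eigenvalues, each given by its representative in the closed upper half
plane: those for which there is a negative eigenvector. -/
def negativeClasses {n : ℕ} (g : Sp n) : Set ℂ :=
  {l | 0 ≤ l.im ∧ ∃ v : Vec n,
    (herm v v).re < 0 ∧ mat g *ᵥ v = MulOpposite.op (l : ℍ) • v}

/-! ## Eigenframes, associated points and the canonical orbit -/

/-- The two kinds of semisimple elements. -/
inductive Kind : Type
  | hyperbolic : Kind
  | elliptic : Kind

/-- The Gram matrix of an orthonormal eigenframe: for a hyperbolic element the frame is
`(a, x₁, …, x_{n-1}, r)` with `⟨a, a⟩ = ⟨r, r⟩ = 0`, `⟨a, r⟩ = 1`, `⟨x_i, x_j⟩ = δ_ij` and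
`a, r` orthogonal to the `x_i`; for an elliptic element it is `(x₁, …, x_{n+1})`, orthogonal, with
`⟨x₁, x₁⟩ = -1` and `⟨x_j, x_j⟩ = 1` for `j ≠ 1`. -/
def gram (n : ℕ) : Kind → Mat n
  | Kind.hyperbolic => siegel n
  | Kind.elliptic => Matrix.diagonal fun j => if j = 0 then -1 else 1

/-- The conventions for the list of eigenvalue representatives along an eigenframe. They are chosen
in the closed upper half plane. For a hyperbolic element the first one, at the attracting fixed
point, has modulus greater than one. The representatives at the positive vectors are listed by
increasing argument, so that the list is determined by the element. -/
def NormalizedEigenvalues {n : ℕ} (k : Kind) (l : Fin (n + 1) → ℂ) : Prop :=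
  (∀ j, 0 ≤ (l j).im) ∧
    match k with
    | Kind.hyperbolic => 1 < ‖l 0‖ ∧
        ∀ i j, 0 < i → i ≤ j → j < Fin.last n → (l i).arg ≤ (l j).arg
    | Kind.elliptic => ∀ i j, 0 < i → i ≤ j → (l i).arg ≤ (l j).arg

/-- The columns of `E` form an orthonormal eigenframe of `g`, of kind `k`, the `j`-th column being
an eigenvector for the `j`-th entry of `l`. -/
def IsEigenframe {n : ℕ} (k : Kind) (g : Sp n) (l : Fin (n + 1) → ℂ) (E : Mat n) : Prop :=
  NormalizedEigenvalues k l ∧ Eᴴ * siegel n * E = gram n k ∧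
    mat g * E = E * Matrix.diagonal fun j => (l j : ℍ)

/-- The group `G_A` of changes of eigenframes: the block diagonal matrices, with blocks given by
the coincidences in the list of eigenvalues, that preserve the Gram matrix of the frame. It is
`ℍ* × Sp(m₁) × … × Sp(m_k)`, with `λ ∈ ℍ*` acting by `a ↦ a λ`, `r ↦ r (conj λ)⁻¹`, for a hyperbolic
element and `Sp(m₁ - 1, 1) × Sp(m₂) × … × Sp(m_k)` for an elliptic one. -/
def IsFrameChange {n : ℕ} (k : Kind) (l : Fin (n + 1) → ℂ) (M : Mat n) : Prop :=
  Mᴴ * gram n k * M = gram n k ∧ ∀ i j, l i ≠ l j → M i j = 0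

/-- `P` belongs to the orbit of an eigenframe of `g` under changes of eigenframes. -/
def InFrameOrbit {n : ℕ} (k : Kind) (g : Sp n) (P : Mat n) : Prop :=
  ∃ l E M, IsEigenframe k g l E ∧ IsFrameChange k l M ∧ P = E * M

/-- The vectors that span the associated points of a frame: `a`, `r` and `(a - r)/√2 + x_j` for a
hyperbolic element, `x₁` and `x₁ √2 + x_j` for an elliptic one. -/
def assocVec {n : ℕ} (k : Kind) (P : Mat n) (j : Fin (n + 1)) : Vec n :=
  match k with
  | Kind.hyperbolic =>
      if j = 0 ∨ j = Fin.last n then P.col j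
      else (Real.sqrt 2)⁻¹ • (P.col 0 - P.col (Fin.last n)) + P.col j
  | Kind.elliptic =>
      if j = 0 then P.col 0 else Real.sqrt 2 • P.col 0 + P.col j

/-- The relative normalization `⟨r_A, a_B⟩ = 1` of the frames of two hyperbolic elements `A`, `B`.
It is possible exactly if the points `r_A` and `a_B` are distinct, that is, if `⟨r_A, a_B⟩ ≠ 0`;
this is so in particular if `A` and `B` have no common fixed point. -/
def NormalizedPair {n : ℕ} (k k' : Kind) (P Q : Mat n) : Prop :=
  k = Kind.hyperbolic → k' = Kind.hyperbolic →
    herm (P.col (Fin.last n)) (Q.col 0) ≠ 0 → herm (P.col (Fin.last n)) (Q.col 0) = 1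

/-- `p` is a tuple of `2n+2` associated points of the pair `(A, B)`, the first `n+1` of them for `A`
and the others for `B`. -/
def IsAssociated {n : ℕ} (A B : Sp n) (p : Fin (n + 1) ⊕ Fin (n + 1) → ClosedHyp n) : Prop :=
  ∃ k k' P Q, InFrameOrbit k A P ∧ InFrameOrbit k' B Q ∧ NormalizedPair k k' P Q ∧
    (∀ j, (p (Sum.inl j)).1.submodule = Submodule.span ℍᵐᵒᵖ {assocVec k P j}) ∧
    (∀ j, (p (Sum.inr j)).1.submodule = Submodule.span ℍᵐᵒᵖ {assocVec k' Q j})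

/-- The canonical orbit of the pair `(A, B)`: the orbit, under the changes of the eigenframes of
`A` and `B`, of the congruence class of a tuple of associated points. The orbit space `𝒬ℒ_n` is the
set of these orbits. -/
def canonicalOrbit {n : ℕ} (A B : Sp n) : Set (Moduli n (Fin (n + 1) ⊕ Fin (n + 1))) :=
  {c | ∃ p, IsAssociated A B p ∧ Quotient.mk (congruence n _) p = c}

/-- The element `C` realizes a coincidence of the canonical orbits of `(A, B)` and `(A', B')`: it
carries a tuple of associated points of `(A, B)` to one of `(A', B')`. It then carries the
eigenspaces of `A` and `B` to those of `A'` and `B'`, in the order of the eigenvalue lists. -/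
def MatchesOrbits {n : ℕ} (A B A' B' C : Sp n) : Prop :=
  ∃ p q, IsAssociated A B p ∧ IsAssociated A' B' q ∧ ∀ i, C • (p i).1 = (q i).1

/-- The pairs `(A, B)` and `(A', B')` have the same canonical orbit and, after the identification
of their eigenspaces by an element `C` that realizes the coincidence of the canonical orbits, the
same point on each of the eigenvalue Grassmannians of the two elements. A class of eigenvalues that
is not real has exactly one representative `λ` with positive imaginary part. -/
def SameGrassmannianPoints {n : ℕ} (A B A' B' : Sp n) : Prop :=
  ∃ C : Sp n, MatchesOrbits A B A' B' C ∧
    ∀ (l : ℂ) (hl : 0 < l.im),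
      Carries C (eigenPoint (mat A) l hl.ne') (eigenPoint (mat A') l hl.ne') ∧
      Carries C (eigenPoint (mat B) l hl.ne') (eigenPoint (mat B') l hl.ne')

end QHyp

end

noncomputable section

namespace QHyp

/-! Every datum is natural under conjugation, so one direction is transport of structure. Its only
existence claim is that some tuple of associated points exists, which needs an orthonormal
eigenframe of each semisimple element (`IsSemisimple.exists_isEigenframe`). If some eigenvalue has
modulus different from 1, its eigenvector is null and pairs with a null eigenvector of inverse
modulus. Otherwise a negative eigenvector exists. Either way the complement is positive definite and
is diagonalized by induction.

For the converse, let `C` match the associated points and the eigensets. Three facts make `C`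
conjugate `A` to `A'`. The associated points are rigid. Comparing their pairings forces `C` to
multiply all frame vectors by one common quaternion, so lines of one frame go to lines of the other,
and the kinds agree (`exists_smul_col_of_assocVec`). The eigenvalue list is determined by the kind,
the real trace and the negative class (`IsEigenframe.eigenvalues_eq`): the characteristic polynomial
gives the multiset, and the normalization gives the positions. On a frame vector with real
eigenvalue, `A` is a central scalar, so preserving the line is enough for `C A = A' C`. For a
non-real class the line does not determine the action, because frame changes mix eigenvectors with
quaternionic coefficients. There the Grassmannian point supplies the relation on the eigenset, hence
on its quaternionic span (`Carries.mulVec_mulVec`). A frame is a basis, so `C A = A' C`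
(`conj_eq_of_carries`). The same `C` serves both generators. -/

/-! ### The Hermitian form and its signature. -/

lemma siegel_mulVec {n : ℕ} (z : Vec n) (i : Fin (n + 1)) :
    (siegel n *ᵥ z) i = z (Equiv.swap 0 (Fin.last n) i) := by
  simp [siegel, Matrix.mulVec, dotProduct]

lemma herm_apply {n : ℕ} (z w : Vec n) :
    herm z w = ∑ i, star (w i) * z (Equiv.swap 0 (Fin.last n) i) := by
  simp [herm, dotProduct, siegel_mulVec]

lemma herm_add_left {n : ℕ} (u v w : Vec n) : herm (u + v) w = herm u w + herm v w := by
  simp [herm_apply, mul_add, Finset.sum_add_distrib]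

lemma herm_add_right {n : ℕ} (u v w : Vec n) : herm u (v + w) = herm u v + herm u w := by
  simp [herm_apply, add_mul, Finset.sum_add_distrib]

lemma herm_smul_left {n : ℕ} (q : ℍ) (v w : Vec n) :
    herm (MulOpposite.op q • v) w = herm v w * q := by
  simp [herm_apply, Finset.sum_mul, mul_assoc]

lemma herm_smul_right {n : ℕ} (q : ℍ) (v w : Vec n) :
    herm v (MulOpposite.op q • w) = star q * herm v w := by
  simp [herm_apply, Finset.mul_sum, mul_assoc]

@[simp] lemma herm_zero_left {n : ℕ} (w : Vec n) : herm 0 w = 0 := by simp [herm_apply]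

@[simp] lemma herm_zero_right {n : ℕ} (w : Vec n) : herm w 0 = 0 := by simp [herm_apply]

lemma herm_sub_left {n : ℕ} (u v w : Vec n) : herm (u - v) w = herm u w - herm v w := by
  simp [herm_apply, mul_sub, Finset.sum_sub_distrib]

lemma herm_sub_right {n : ℕ} (u v w : Vec n) : herm u (v - w) = herm u v - herm u w := by
  simp [herm_apply, sub_mul, Finset.sum_sub_distrib]

lemma real_smul_eq {n : ℕ} (t : ℝ) (v : Vec n) : t • v = MulOpposite.op (t : ℍ) • v := by
  funext i
  simp [Quaternion.coe_commutes, ← Quaternion.coe_mul_eq_smul]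

lemma herm_real_smul_left {n : ℕ} (t : ℝ) (v w : Vec n) : herm (t • v) w = t • herm v w := by
  rw [real_smul_eq, herm_smul_left, Quaternion.mul_coe_eq_smul]

lemma herm_real_smul_right {n : ℕ} (t : ℝ) (v w : Vec n) : herm v (t • w) = t • herm v w := by
  rw [real_smul_eq, herm_smul_right, Quaternion.star_coe, Quaternion.coe_mul_eq_smul]

lemma star_herm {n : ℕ} (v w : Vec n) : star (herm v w) = herm w v := by
  simp only [herm_apply, star_sum, star_mul, star_star]
  rw [← Equiv.sum_comp (Equiv.swap 0 (Fin.last n))]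
  simp

lemma herm_eq_zero_comm {n : ℕ} {v w : Vec n} (h : herm v w = 0) : herm w v = 0 := by
  rw [← star_herm, h, star_zero]

lemma herm_self_eq_coe {n : ℕ} (v : Vec n) : herm v v = ((herm v v).re : ℍ) :=
  Quaternion.star_eq_self.1 (star_herm v v)

lemma herm_sum_left {n : ℕ} {ι : Type*} (s : Finset ι) (f : ι → Vec n) (w : Vec n) :
    herm (∑ i ∈ s, f i) w = ∑ i ∈ s, herm (f i) w := by
  induction s using Finset.cons_induction with
  | empty => simp
  | cons i s hi ih => simp [herm_add_left, ih]

lemma herm_sum_right {n : ℕ} {ι : Type*} (s : Finset ι) (f : ι → Vec n) (w : Vec n) :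
    herm w (∑ i ∈ s, f i) = ∑ i ∈ s, herm w (f i) := by
  rw [← star_herm, herm_sum_left, star_sum]
  simp [star_herm]

lemma herm_nondegenerate {n : ℕ} {v : Vec n} (h : ∀ w, herm v w = 0) : v = 0 := by
  funext i
  have := h (Pi.single (Equiv.swap 0 (Fin.last n) i) 1)
  rw [herm_apply, Finset.sum_eq_single (Equiv.swap 0 (Fin.last n) i)] at this
  · simpa using this
  · intro j _ hj
    simp [Pi.single_eq_of_ne hj]
  · simp

lemma conjTranspose_siegel_mul_apply {n : ℕ} (P Q : Mat n) (i j : Fin (n + 1)) :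
    (Pᴴ * siegel n * Q) i j = herm (Q.col j) (P.col i) := by
  rw [Matrix.mul_assoc, Matrix.mul_apply, herm, dotProduct]
  refine Finset.sum_congr rfl fun k _ => ?_
  rfl

lemma conjTranspose_mul_siegel_mul {n : ℕ} (g : Sp n) : (mat g)ᴴ * siegel n * mat g = siegel n :=
  g.2

lemma herm_mulVec {n : ℕ} (g : Sp n) (v w : Vec n) :
    herm (mat g *ᵥ v) (mat g *ᵥ w) = herm v w := by
  conv_rhs => rw [herm, ← conjTranspose_mul_siegel_mul g]
  rw [herm, Matrix.star_mulVec, ← Matrix.dotProduct_mulVec]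
  simp [Matrix.mulVec_mulVec, Matrix.mul_assoc]

@[simp] lemma mat_mul {n : ℕ} (g h : Sp n) : mat (g * h) = mat g * mat h := rfl

@[simp] lemma mat_one {n : ℕ} : mat (1 : Sp n) = 1 := rfl

lemma mat_injective {n : ℕ} : Function.Injective (mat : Sp n → Mat n) := fun _ _ h =>
  Subtype.ext (Units.ext h)

lemma mat_mul_mat_inv {n : ℕ} (g : Sp n) : mat g * mat g⁻¹ = 1 := by
  rw [← mat_mul, mul_inv_cancel, mat_one]

lemma mat_inv_mul_mat {n : ℕ} (g : Sp n) : mat g⁻¹ * mat g = 1 := by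
  rw [← mat_mul, inv_mul_cancel, mat_one]

lemma re_sum {ι : Type*} (s : Finset ι) (f : ι → ℍ) : (∑ i ∈ s, f i).re = ∑ i ∈ s, (f i).re := by
  induction s using Finset.cons_induction with
  | empty => simp
  | cons i s hi ih => simp [ih]

/-- On this hyperplane the exchange of the end coordinates is invisible and the form is the standard
definite one. A positive definite hyperplane is all that is needed to control the signature. -/
lemma herm_self_of_eq {n : ℕ} {z : Vec n} (h : z 0 = z (Fin.last n)) :
    (herm z z).re = ∑ i, Quaternion.normSq (z i) := by
  have : ∀ i, z (Equiv.swap 0 (Fin.last n) i) = z i := by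
    intro i
    rcases eq_or_ne i 0 with rfl | h0
    · simp [h]
    rcases eq_or_ne i (Fin.last n) with rfl | h1
    · simp [h]
    rw [Equiv.swap_apply_of_ne_of_ne h0 h1]
  rw [herm_apply]
  simp [this, re_sum, Quaternion.star_mul_self]

lemma star_mul_coe_mul (t : ℝ) (c : ℍ) :
    star c * (t : ℍ) * c = ((t * Quaternion.normSq c : ℝ) : ℍ) := by
  rw [mul_assoc, Quaternion.coe_commutes, ← mul_assoc, Quaternion.star_mul_self,
    ← Quaternion.coe_mul, mul_comm]

/-- The orthogonal complement of a negative vector is positive definite. -/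
lemma herm_self_pos_of_orthogonal {n : ℕ} {v w : Vec n} (hv : (herm v v).re < 0)
    (hw : herm w v = 0) (hw0 : w ≠ 0) : 0 < (herm w w).re := by
  by_contra! hle
  have hφ : v 0 - v (Fin.last n) ≠ 0 := by
    intro h
    rw [herm_self_of_eq (sub_eq_zero.1 h)] at hv
    exact hv.not_ge (Finset.sum_nonneg fun i _ => Quaternion.normSq_nonneg)
  -- The plane spanned by `v` and `w` must meet the positive definite hyperplane. This `c` puts `w -
  -- v c` into it, while orthogonality keeps the form nonpositive there, so `w = v c`.
  set c : ℍ := (v 0 - v (Fin.last n))⁻¹ * (w 0 - w (Fin.last n)) with hc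
  set u : Vec n := w - MulOpposite.op c • v with hu
  have hu0 : u 0 = u (Fin.last n) := by
    have : (v 0 - v (Fin.last n)) * c = w 0 - w (Fin.last n) := by
      rw [hc, mul_inv_cancel_left₀ hφ]
    rw [sub_mul] at this
    simp only [hu, Pi.sub_apply, Pi.smul_apply, MulOpposite.smul_eq_mul_unop,
      MulOpposite.unop_op]
    rw [sub_eq_sub_iff_sub_eq_sub, ← this]
  have hvw := herm_eq_zero_comm hw
  have huu : (herm u u).re = (herm w w).re + (herm v v).re * Quaternion.normSq c := by
    rw [hu]
    rw [herm_sub_left, herm_sub_right, herm_sub_right, herm_smul_left, herm_smul_right,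
      herm_smul_left, herm_smul_right, hw, hvw, herm_self_eq_coe v, star_mul_coe_mul]
    simp
  have h1 := herm_self_of_eq hu0
  have h2 : ∑ i, Quaternion.normSq (u i) = 0 := by
    refine le_antisymm ?_ (Finset.sum_nonneg fun i _ => Quaternion.normSq_nonneg)
    rw [← h1, huu]
    nlinarith [Quaternion.normSq_nonneg (a := c)]
  have hu' : u = 0 := by
    funext i
    exact Quaternion.normSq_eq_zero.1
      ((Finset.sum_eq_zero_iff_of_nonneg fun i _ => Quaternion.normSq_nonneg).1 h2 i
        (Finset.mem_univ i))
  have hwc : w = MulOpposite.op c • v := sub_eq_zero.1 hu'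
  rw [hwc, herm_smul_left] at hw
  rcases mul_eq_zero.1 hw with h | h
  · rw [h] at hv; simp at hv
  · rw [hwc, h] at hw0; simp at hw0

/-! ## The complex matrix of a quaternionic matrix -/

/-- The component `z` of a quaternion `z + j w`. -/
def complexPart : ℍ →+ ℂ where
  toFun a := ⟨a.re, a.imI⟩
  map_zero' := rfl
  map_add' _ _ := rfl

/-- The component `w` of a quaternion `z + j w`. -/
def complexPartJ : ℍ →+ ℂ where
  toFun a := ⟨a.imJ, -a.imK⟩
  map_zero' := by simp [Complex.ext_iff]
  map_add' a b := by simp [Complex.ext_iff, add_comm]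

lemma complexPart_apply (a : ℍ) : complexPart a = ⟨a.re, a.imI⟩ := rfl

lemma complexPartJ_apply (a : ℍ) : complexPartJ a = ⟨a.imJ, -a.imK⟩ := rfl

/-- The conjugate arises from moving `j` to the left past a complex number, `z j = j (conj z)`. -/
lemma complexPart_mul (a b : ℍ) : complexPart (a * b) =
    complexPart a * complexPart b - star (complexPartJ a) * complexPartJ b := by
  simp only [complexPart_apply, complexPartJ_apply]
  apply Complex.ext <;> simp <;> ring

lemma complexPartJ_mul (a b : ℍ) : complexPartJ (a * b) =
    complexPartJ a * complexPart b + star (complexPart a) * complexPartJ b := by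
  simp only [complexPart_apply, complexPartJ_apply]
  apply Complex.ext <;> simp <;> ring

@[simp] lemma complexPart_coe (z : ℂ) : complexPart (z : ℍ) = z := rfl

@[simp] lemma complexPartJ_coe (z : ℂ) : complexPartJ (z : ℍ) = 0 := by
  simp [complexPartJ_apply, Complex.ext_iff]

lemma complexRep_eq {n : ℕ} (A : Mat n) : complexRep A =
    Matrix.fromBlocks (A.map complexPart) (-(A.map complexPartJ).map star)
      (A.map complexPartJ) ((A.map complexPart).map star) := rfl

lemma complexRep_mul {n : ℕ} (A B : Mat n) :
    complexRep (A * B) = complexRep A * complexRep B := by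
  rw [complexRep_eq, complexRep_eq, complexRep_eq, Matrix.fromBlocks_multiply]
  congr 1 <;> ext i j <;>
    simp only [Matrix.map_apply, Matrix.neg_apply, Matrix.add_apply, Matrix.mul_apply,
      map_sum, star_sum, complexPart_mul, complexPartJ_mul, ← Finset.sum_add_distrib,
      ← Finset.sum_neg_distrib] <;>
    refine Finset.sum_congr rfl fun k _ => ?_ <;> simp <;> ring

lemma complexRep_diagonal {n : ℕ} (l : Fin (n + 1) → ℂ) :
    complexRep (Matrix.diagonal fun j => (l j : ℍ)) =
      Matrix.fromBlocks (Matrix.diagonal l) 0 0 (Matrix.diagonal fun j => star (l j)) := by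
  rw [complexRep_eq]
  congr 1 <;> ext i j <;> rcases eq_or_ne i j with rfl | h <;>
    simp [Matrix.diagonal_apply_ne, *]

lemma complexRep_one {n : ℕ} : complexRep (1 : Mat n) = 1 := by
  have := complexRep_diagonal (n := n) fun _ => 1
  simpa using this

lemma charpoly_complexRep_eq {n : ℕ} {A D E F : Mat n} (h : A * E = E * D) (hF : F * E = 1) :
    (complexRep A).charpoly = (complexRep D).charpoly := by
  have h1 : complexRep F * complexRep E = 1 := by rw [← complexRep_mul, hF, complexRep_one]
  -- Over `ℂ` a one-sided inverse of a square matrix is two-sided.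
  have h2 : complexRep E * complexRep F = 1 := mul_eq_one_comm.1 h1
  have h3 : complexRep A = complexRep E * complexRep D * complexRep F := by
    rw [← complexRep_mul, ← h, complexRep_mul, Matrix.mul_assoc, h2, Matrix.mul_one]
  rw [h3, Matrix.charpoly_mul_comm, ← Matrix.mul_assoc, h1, Matrix.one_mul]

lemma charpoly_complexRep_diagonal {n : ℕ} (l : Fin (n + 1) → ℂ) :
    (complexRep (Matrix.diagonal fun j => (l j : ℍ))).charpoly =
      (∏ j, (Polynomial.X - Polynomial.C (l j))) *
        ∏ j, (Polynomial.X - Polynomial.C (star (l j))) := by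
  rw [complexRep_diagonal, Matrix.charpoly_fromBlocks_zero₁₂, Matrix.charpoly_diagonal,
    Matrix.charpoly_diagonal]

lemma realTrace_eq_iff {n : ℕ} (g h : Sp n) : realTrace g = realTrace h ↔
    (complexRep (mat g)).charpoly = (complexRep (mat h)).charpoly := by
  rw [Polynomial.ext_iff, funext_iff]
  rfl

/-! ## Eigenvectors -/

/-- Invariance of the form, read on eigenvectors. All orthogonality relations and all constraints on
eigenvalues come from this identity. -/
lemma star_mul_herm_mul_of_eigenvectors {n : ℕ} {g : Sp n} {p q : ℍ} {v w : Vec n}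
    (hv : mat g *ᵥ v = MulOpposite.op p • v) (hw : mat g *ᵥ w = MulOpposite.op q • w) :
    star q * herm v w * p = herm v w := by
  conv_rhs => rw [← herm_mulVec g v w, hv, hw, herm_smul_left, herm_smul_right]

lemma coeComplex_mul_unitJ (z : ℂ) : (z : ℍ) * unitJ = unitJ * ((star z : ℂ) : ℍ) := by
  ext <;> simp [unitJ_re, unitJ_imI, unitJ_imJ, unitJ_imK]

lemma unitJ_mul_star : star unitJ * unitJ = 1 := by
  ext <;> simp [unitJ_re, unitJ_imI, unitJ_imJ, unitJ_imK]

lemma mulVec_op_smul {n : ℕ} {A : Mat n} {v : Vec n} {p q r : ℍ}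
    (hv : A *ᵥ v = MulOpposite.op p • v) (h : p * q = q * r) :
    A *ᵥ (MulOpposite.op q • v) = MulOpposite.op r • MulOpposite.op q • v := by
  rw [Matrix.mulVec_smul, hv, smul_smul, smul_smul, ← MulOpposite.op_mul, ← MulOpposite.op_mul, h]

lemma norm_coeComplex (z : ℂ) : ‖(z : ℍ)‖ = ‖z‖ := by
  rw [← sq_eq_sq₀ (norm_nonneg _) (norm_nonneg _), sq, ← Quaternion.normSq_eq_norm_mul_self,
    Quaternion.normSq_def', ← Complex.normSq_eq_norm_sq, Complex.normSq_apply]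
  simp [sq]

/-- Similar quaternions share real part and norm, which fix a complex number up to conjugation.
Hence a similarity class has a single representative in the closed upper half plane. -/
lemma coeComplex_eq_of_im_nonneg {z w : ℂ} {q : ℍ} (hz : 0 ≤ z.im) (hw : 0 ≤ w.im) (hq : q ≠ 0)
    (h : (z : ℍ) * q = q * (w : ℍ)) : z = w := by
  have hre : z.re = w.re := by
    have h1 : (q⁻¹ * ((z : ℍ) * q)).re = (w : ℍ).re := by rw [h, inv_mul_cancel_left₀ hq]
    have h2 : ∀ a b : ℍ, (a * b).re = (b * a).re := fun a b => by simp; ring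
    rw [h2, mul_assoc, mul_inv_cancel₀ hq, mul_one] at h1
    simpa using h1
  have hn : ‖z‖ = ‖w‖ := by
    have := congrArg norm h
    rw [norm_mul, norm_mul, mul_comm] at this
    have := mul_left_cancel₀ (norm_ne_zero_iff.2 hq) this
    simpa only [norm_coeComplex] using this
  have hn2 : z.re * z.re + z.im * z.im = w.re * w.re + w.im * w.im := by
    rw [← Complex.normSq_apply, ← Complex.normSq_apply, Complex.normSq_eq_norm_sq,
      Complex.normSq_eq_norm_sq, hn]
  rw [hre, add_right_inj] at hn2
  exact Complex.ext hre ((mul_self_inj hz hw).1 hn2)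

/-- An eigenvector can be multiplied by a unit so that the eigenvalue is in the closed upper half
plane. -/
lemma exists_eigenvector_im_nonneg {n : ℕ} {A : Mat n} {v : Vec n} {l : ℂ}
    (hv : A *ᵥ v = MulOpposite.op (l : ℍ) • v) :
    ∃ (q : ℍ) (m : ℂ), star q * q = 1 ∧ 0 ≤ m.im ∧ ‖m‖ = ‖l‖ ∧
      A *ᵥ (MulOpposite.op q • v) = MulOpposite.op (m : ℍ) • MulOpposite.op q • v := by
  rcases le_total 0 l.im with h | h
  · exact ⟨1, l, by simp, h, rfl, mulVec_op_smul hv (by simp)⟩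
  · exact ⟨unitJ, star l, unitJ_mul_star, by simpa using h, by simp,
      mulVec_op_smul hv (coeComplex_mul_unitJ l)⟩

/-- Column vectors as complex column vectors of twice the length. -/
def toComplexVec (n : ℕ) : Vec n ≃+ (Fin (n + 1) ⊕ Fin (n + 1) → ℂ) where
  toFun v := Sum.elim (fun i => complexPart (v i)) fun i => complexPartJ (v i)
  invFun u i := ⟨(u (Sum.inl i)).re, (u (Sum.inl i)).im, (u (Sum.inr i)).re, -(u (Sum.inr i)).im⟩
  left_inv v := by
    funext i
    apply Quaternion.ext <;> first | rfl | exact neg_neg _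
  right_inv u := by
    funext i
    rcases i with i | i
    · exact Complex.ext rfl rfl
    · exact Complex.ext rfl (neg_neg _)
  map_add' v w := by
    funext i
    rcases i with i | i <;> simp

@[simp] lemma toComplexVec_inl {n : ℕ} (v : Vec n) (i : Fin (n + 1)) :
    toComplexVec n v (Sum.inl i) = complexPart (v i) := rfl

@[simp] lemma toComplexVec_inr {n : ℕ} (v : Vec n) (i : Fin (n + 1)) :
    toComplexVec n v (Sum.inr i) = complexPartJ (v i) := rfl

/-- With `j` on the left in `z + j w`, right multiplication by a complex number scales both
components alike. So right eigenvectors become ordinary complex eigenvectors. -/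
lemma toComplexVec_smul {n : ℕ} (z : ℂ) (v : Vec n) :
    toComplexVec n (MulOpposite.op (z : ℍ) • v) = z • toComplexVec n v := by
  funext i
  rcases i with i | i <;> simp [complexPart_mul, complexPartJ_mul, mul_comm]

lemma toComplexVec_mulVec {n : ℕ} (A : Mat n) (v : Vec n) :
    toComplexVec n (A *ᵥ v) = complexRep A *ᵥ toComplexVec n v := by
  funext i
  rcases i with i | i <;>
    simp [complexRep_eq, Matrix.mulVec, dotProduct, complexPart_mul,
      complexPartJ_mul, Finset.sum_add_distrib, sub_eq_add_neg]

lemma mulVec_eq_iff_toComplexVec {n : ℕ} (A : Mat n) (l : ℂ) (v : Vec n) :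
    A *ᵥ v = MulOpposite.op (l : ℍ) • v ↔
      Matrix.toLin' (complexRep A) (toComplexVec n v) = l • toComplexVec n v := by
  rw [Matrix.toLin'_apply, ← toComplexVec_mulVec, ← toComplexVec_smul, EquivLike.apply_eq_iff_eq]

/-- Every vector is a sum of eigenvectors of a semisimple element. -/
lemma IsSemisimple.exists_sum_eigenvectors {n : ℕ} {g : Sp n} (hg : IsSemisimple g) (v : Vec n) :
    ∃ (s : Finset ℂ) (f : ℂ → Vec n),
      (∀ l, mat g *ᵥ f l = MulOpposite.op (l : ℍ) • f l) ∧ ∑ l ∈ s, f l = v := by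
  -- Over `ℂ` the generalized eigenspaces span, and semisimplicity turns them into eigenspaces.
  have h1 := Module.End.iSup_maxGenEigenspace_eq_top (Matrix.toLin' (complexRep (mat g)))
  simp only [hg.isFinitelySemisimple.maxGenEigenspace_eq_eigenspace] at h1
  have h2 : toComplexVec n v ∈
      ⨆ l, Module.End.eigenspace (Matrix.toLin' (complexRep (mat g))) l := by rw [h1]; trivial
  obtain ⟨f, hf, hs⟩ := (Submodule.mem_iSup_iff_exists_finsupp _ _).1 h2
  refine ⟨f.support, fun l => (toComplexVec n).symm (f l), fun l => ?_, ?_⟩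
  · rw [mulVec_eq_iff_toComplexVec, AddEquiv.apply_symm_apply]
    exact Module.End.mem_eigenspace_iff.1 (hf l)
  · rw [← map_sum, AddEquiv.symm_apply_eq]
    exact hs

/-- An invariant subspace contains an eigenvector. -/
lemma exists_eigenvector_mem {n : ℕ} {A : Mat n} {W : Submodule ℍᵐᵒᵖ (Vec n)}
    (hA : ∀ w ∈ W, A *ᵥ w ∈ W) (hW : W ≠ ⊥) :
    ∃ v ∈ W, ∃ l : ℂ, v ≠ 0 ∧ A *ᵥ v = MulOpposite.op (l : ℍ) • v := by
  -- `W` seen as a complex subspace, where an eigenvalue exists by algebraic closedness.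
  let U : Submodule ℂ (Fin (n + 1) ⊕ Fin (n + 1) → ℂ) :=
    { carrier := {u | (toComplexVec n).symm u ∈ W}
      add_mem' := by
        intro u w hu hw
        simp only [Set.mem_ofPred_eq, map_add] at hu hw ⊢
        exact W.add_mem hu hw
      zero_mem' := by simp
      smul_mem' := by
        intro z u hu
        simp only [Set.mem_ofPred_eq] at hu ⊢
        have : (toComplexVec n).symm (z • u) =
            MulOpposite.op (z : ℍ) • (toComplexVec n).symm u := by
          rw [AddEquiv.symm_apply_eq, toComplexVec_smul, AddEquiv.apply_symm_apply]
        rw [this]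
        exact W.smul_mem _ hu }
  have hU : ∀ u ∈ U, Matrix.toLin' (complexRep A) u ∈ U := by
    intro u hu
    have : (toComplexVec n).symm (Matrix.toLin' (complexRep A) u) =
        A *ᵥ (toComplexVec n).symm u := by
      rw [AddEquiv.symm_apply_eq, toComplexVec_mulVec, AddEquiv.apply_symm_apply,
        Matrix.toLin'_apply]
    change (toComplexVec n).symm _ ∈ W
    rw [this]
    exact hA _ hu
  obtain ⟨w, hw, hw0⟩ := W.ne_bot_iff.1 hW
  have hne : Nontrivial U := by
    refine ⟨⟨⟨toComplexVec n w, ?_⟩, 0, ?_⟩⟩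
    · change (toComplexVec n).symm (toComplexVec n w) ∈ W
      simpa using hw
    · simpa [Subtype.ext_iff] using hw0
  obtain ⟨l, hl⟩ := Module.End.exists_eigenvalue ((Matrix.toLin' (complexRep A)).restrict hU)
  obtain ⟨u, hu, hu0⟩ := hl.exists_hasEigenvector
  refine ⟨(toComplexVec n).symm u.1, u.2, l, ?_, ?_⟩
  · simpa using hu0
  · rw [mulVec_eq_iff_toComplexVec, AddEquiv.apply_symm_apply]
    exact congrArg Subtype.val (Module.End.mem_eigenspace_iff.1 hu)

/-! ## Orthogonal complements -/

/-- The functional `w ↦ ⟨w, v⟩`. -/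
def hermFunctional {n : ℕ} (v : Vec n) : Vec n →ₗ[ℍᵐᵒᵖ] ℍᵐᵒᵖ where
  toFun w := MulOpposite.op (herm w v)
  map_add' u w := by rw [herm_add_left, MulOpposite.op_add]
  map_smul' q w := by
    conv_lhs => rw [← MulOpposite.op_unop q, herm_smul_left, MulOpposite.op_mul]
    simp

lemma mem_ker_hermFunctional {n : ℕ} {v w : Vec n} :
    w ∈ LinearMap.ker (hermFunctional v) ↔ herm w v = 0 := by
  simp [hermFunctional]

/-- The coordinates of a vector, as elements of the opposite ring. -/
def opCoordinates (n : ℕ) : Vec n ≃ₗ[ℍᵐᵒᵖ] (Fin (n + 1) → ℍᵐᵒᵖ) where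
  toFun v i := MulOpposite.op (v i)
  invFun v i := MulOpposite.unop (v i)
  left_inv _ := rfl
  right_inv _ := rfl
  map_add' _ _ := rfl
  map_smul' _ _ := rfl

instance (n : ℕ) : FiniteDimensional ℍᵐᵒᵖ (Vec n) := Module.Finite.equiv (opCoordinates n).symm

lemma finrank_vec (n : ℕ) : Module.finrank ℍᵐᵒᵖ (Vec n) = n + 1 := by
  rw [(opCoordinates n).finrank_eq, Module.finrank_fin_fun]

/-- Rank-nullity for a functional that is onto because it does not vanish at `u`. Two vectors are
allowed so that it also applies to a null `v`, with `u` a vector that pairs with it. -/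
lemma finrank_inf_ker_hermFunctional {n : ℕ} {W : Submodule ℍᵐᵒᵖ (Vec n)} {u v : Vec n}
    (hu : u ∈ W) (huv : herm u v ≠ 0) :
    Module.finrank ℍᵐᵒᵖ ↥(W ⊓ LinearMap.ker (hermFunctional v)) + 1 = Module.finrank ℍᵐᵒᵖ W := by
  have h1 := LinearMap.finrank_range_add_finrank_ker ((hermFunctional v).domRestrict W)
  have h2 : LinearMap.range ((hermFunctional v).domRestrict W) = ⊤ := by
    rw [LinearMap.range_eq_top]
    intro c
    refine ⟨(c * (MulOpposite.op (herm u v))⁻¹) • ⟨u, hu⟩, ?_⟩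
    rw [map_smul]
    change (c * (MulOpposite.op (herm u v))⁻¹) * MulOpposite.op (herm u v) = c
    rw [inv_mul_cancel_right₀]
    simpa using huv
  have h3 : Module.finrank ℍᵐᵒᵖ (LinearMap.ker ((hermFunctional v).domRestrict W)) =
      Module.finrank ℍᵐᵒᵖ ↥(W ⊓ LinearMap.ker (hermFunctional v)) := by
    have h4 : LinearMap.ker ((hermFunctional v).domRestrict W) =
        Submodule.comap W.subtype (W ⊓ LinearMap.ker (hermFunctional v)) := by
      ext w
      simp
    rw [h4]
    exact (Submodule.comapSubtypeEquivOfLe inf_le_left).finrank_eq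
  rw [h2, finrank_top, Module.finrank_self, h3] at h1
  omega

/-- `g` preserves the form and the line of `v`; the eigenvalue `q` can be cancelled because `g` is
invertible and `v ≠ 0`. -/
lemma mulVec_mem_ker_hermFunctional {n : ℕ} {g : Sp n} {v w : Vec n} {q : ℍ}
    (hv0 : v ≠ 0)
    (hv : mat g *ᵥ v = MulOpposite.op q • v) (hw : w ∈ LinearMap.ker (hermFunctional v)) :
    mat g *ᵥ w ∈ LinearMap.ker (hermFunctional v) := by
  rw [mem_ker_hermFunctional] at hw ⊢
  rw [← herm_mulVec g, hv, herm_smul_right] at hw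
  refine (mul_eq_zero.1 hw).resolve_left fun h => hv0 ?_
  rw [star_eq_zero.1 h, MulOpposite.op_zero, zero_smul] at hv
  have := congrArg (fun u => mat g⁻¹ *ᵥ u) hv
  simpa [Matrix.mulVec_mulVec, mat_inv_mul_mat] using this

/-! ### Normalized eigenvectors and positive definite invariant subspaces. -/

lemma exists_real_smul_herm_self {n : ℕ} (v : Vec n) :
    ∃ t : ℝ, herm (t • v) (t • v) = (((herm v v).re / |(herm v v).re| : ℝ) : ℍ) := by
  -- For null `v` this scalar is `0` by the convention for inverses, and the target `0 / 0` is `0`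
  -- too. The statement has content only for non-null `v`.
  refine ⟨(Real.sqrt |(herm v v).re|)⁻¹, ?_⟩
  rw [herm_real_smul_left, herm_real_smul_right, smul_smul, ← mul_inv,
    Real.mul_self_sqrt (abs_nonneg _), herm_self_eq_coe v]
  rw [Quaternion.re_coe, ← Quaternion.coe_mul_eq_smul, ← Quaternion.coe_mul, div_eq_inv_mul]

lemma mulVec_real_smul {n : ℕ} {A : Mat n} {v : Vec n} {q : ℍ} (t : ℝ)
    (hv : A *ᵥ v = MulOpposite.op q • v) : A *ᵥ (t • v) = MulOpposite.op q • t • v := by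
  rw [Matrix.mulVec_smul, hv, smul_comm]

lemma exists_unit_eigenvector {n : ℕ} {A : Mat n} {v : Vec n} {l : ℂ}
    (hv : A *ᵥ v = MulOpposite.op (l : ℍ) • v) :
    ∃ (q : ℍ) (m : ℂ), 0 ≤ m.im ∧ ‖m‖ = ‖l‖ ∧
      A *ᵥ (MulOpposite.op q • v) = MulOpposite.op (m : ℍ) • MulOpposite.op q • v ∧
      herm (MulOpposite.op q • v) (MulOpposite.op q • v) =
        (((herm v v).re / |(herm v v).re| : ℝ) : ℍ) := by
  obtain ⟨q, m, hq, hm, hml, h⟩ := exists_eigenvector_im_nonneg hv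
  have hqq : herm (MulOpposite.op q • v) (MulOpposite.op q • v) = herm v v := by
    have hn : Quaternion.normSq q = 1 := by
      rw [Quaternion.star_mul_self] at hq
      exact Quaternion.coe_injective hq
    rw [herm_smul_left, herm_smul_right, herm_self_eq_coe v, star_mul_coe_mul, hn, mul_one]
  obtain ⟨t, ht⟩ := exists_real_smul_herm_self (MulOpposite.op q • v)
  have e : t • MulOpposite.op q • v = MulOpposite.op (q * (t : ℍ)) • v := by
    rw [real_smul_eq, smul_smul, MulOpposite.op_mul]
  refine ⟨q * t, m, hm, hml, ?_, ?_⟩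
  · rw [← e]
    exact mulVec_real_smul t h
  · rw [← e, ht, hqq]

/-- An invariant positive definite subspace has an orthonormal basis of eigenvectors. -/
lemma exists_orthonormal_eigenvectors {n : ℕ} (g : Sp n) (d : ℕ) :
    ∀ W : Submodule ℍᵐᵒᵖ (Vec n), Module.finrank ℍᵐᵒᵖ W = d → (∀ w ∈ W, mat g *ᵥ w ∈ W) →
      (∀ w ∈ W, w ≠ 0 → 0 < (herm w w).re) →
      ∃ (v : Fin d → Vec n) (l : Fin d → ℂ), (∀ i, v i ∈ W) ∧
        (∀ i j, herm (v i) (v j) = if i = j then 1 else 0) ∧ (∀ i, 0 ≤ (l i).im) ∧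
        ∀ i, mat g *ᵥ v i = MulOpposite.op (l i : ℍ) • v i := by
  induction d with
  | zero => exact fun W _ _ _ => ⟨Fin.elim0, Fin.elim0, fun i => i.elim0, fun i => i.elim0,
      fun i => i.elim0, fun i => i.elim0⟩
  | succ d ih =>
    intro W hd hg hW
    have hbot : W ≠ ⊥ := by
      rintro rfl
      simp at hd
    obtain ⟨u, huW, l₀, hu0, hu⟩ := exists_eigenvector_mem hg hbot
    have hpos := hW u huW hu0
    obtain ⟨q, m, hm, -, hv, hvv⟩ := exists_unit_eigenvector hu
    rw [abs_of_pos hpos, div_self hpos.ne', Quaternion.coe_one] at hvv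
    have hvW : MulOpposite.op q • u ∈ W := W.smul_mem _ huW
    generalize MulOpposite.op q • u = v at hv hvv hvW
    have hv0 : v ≠ 0 := by
      rintro rfl
      simp at hvv
    -- Induction passes to the complement of `v` in `W`, which is invariant, still positive, and one
    -- dimension smaller.
    have hfin := finrank_inf_ker_hermFunctional hvW (v := v) (by rw [hvv]; exact one_ne_zero)
    obtain ⟨f, l, hfW, hff, hl, hfe⟩ := ih (W ⊓ LinearMap.ker (hermFunctional v)) (by omega)
      (fun w hw => ⟨hg w hw.1, mulVec_mem_ker_hermFunctional hv0 hv hw.2⟩)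
      (fun w hw => hW w hw.1)
    have hfv : ∀ i, herm (f i) v = 0 := fun i => mem_ker_hermFunctional.1 (hfW i).2
    refine ⟨Fin.cons v f, Fin.cons m l, ?_, ?_, ?_, ?_⟩
    · exact Fin.cases hvW fun i => (hfW i).1
    · refine Fin.cases (Fin.cases ?_ fun j => ?_) fun i => Fin.cases ?_ fun j => ?_
      · simpa using hvv
      · simpa [(Fin.succ_ne_zero j).symm] using herm_eq_zero_comm (hfv j)
      · simpa using hfv i
      · simpa using hff i j
    · exact Fin.cases hm hl
    · exact Fin.cases hv hfe

/-! ### The alternative between hyperbolic and elliptic elements. -/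

lemma norm_mul_norm_eq_one_of_herm_ne_zero {n : ℕ} {g : Sp n} {l m : ℂ} {v w : Vec n}
    (hv : mat g *ᵥ v = MulOpposite.op (l : ℍ) • v) (hw : mat g *ᵥ w = MulOpposite.op (m : ℍ) • w)
    (h : herm v w ≠ 0) : ‖l‖ * ‖m‖ = 1 := by
  have := congrArg norm (star_mul_herm_mul_of_eigenvectors hv hw)
  rw [norm_mul, norm_mul, norm_star, norm_coeComplex, norm_coeComplex] at this
  have hn := norm_ne_zero_iff.2 h
  apply mul_right_cancel₀ hn
  linarith

lemma star_coeComplex (z : ℂ) : star (z : ℍ) = ((star z : ℂ) : ℍ) := by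
  ext <;> simp

/-- The complex component of `⟨v, w⟩` is multiplied by `l / m`, so it vanishes. The `j`-component
may survive, for instance for `v = w j` with `l = conj m`; only the real part is claimed, and it
suffices for sign arguments. -/
lemma re_herm_eq_zero_of_eigenvectors {n : ℕ} {g : Sp n} {l m : ℂ} {v w : Vec n}
    (hv : mat g *ᵥ v = MulOpposite.op (l : ℍ) • v) (hw : mat g *ᵥ w = MulOpposite.op (m : ℍ) • w)
    (hm : ‖m‖ = 1) (hlm : l ≠ m) : (herm v w).re = 0 := by
  have h := congrArg complexPart (star_mul_herm_mul_of_eigenvectors hv hw)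
  rw [star_coeComplex, complexPart_mul, complexPart_mul] at h
  simp only [complexPart_coe, complexPartJ_coe, star_zero, zero_mul, sub_zero, mul_zero] at h
  have hmm : star m * m = 1 := by
    rw [mul_comm]
    simpa [hm] using Complex.mul_conj' m
  have h0 : complexPart (herm v w) = 0 := by
    by_contra h0
    apply hlm
    have h1 : star m * l = 1 := mul_left_cancel₀ h0 (by linear_combination h)
    calc l = star m * m * l := by rw [hmm, one_mul]
      _ = m * (star m * l) := by ring
      _ = m := by rw [h1, mul_one]
  exact congrArg Complex.re h0

/-- For `n = 0` the two end coordinates coincide and the form is positive definite. -/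
lemma exists_negative_vector {n : ℕ} (hn : 1 ≤ n) : ∃ v : Vec n, (herm v v).re < 0 := by
  have h0 : (0 : Fin (n + 1)) ≠ Fin.last n := by
    intro h
    have := congrArg Fin.val h
    simp at this
    omega
  refine ⟨Pi.single 0 1 - Pi.single (Fin.last n) 1, ?_⟩
  have h1 : ∀ i j : Fin (n + 1), herm (Pi.single i 1) (Pi.single j 1) =
      if Equiv.swap 0 (Fin.last n) j = i then (1 : ℍ) else 0 := by
    intro i j
    rw [herm_apply, Finset.sum_eq_single j]
    · simp [Pi.single_apply]
    · intro k _ hk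
      simp [Pi.single_eq_of_ne hk]
    · simp
  simp only [herm_sub_left, herm_sub_right, h1]
  simp [h0, h0.symm]

/-- A semisimple element has a pair of null eigenvectors with product one, or a negative
eigenvector. -/
lemma IsSemisimple.hyperbolic_or_elliptic {n : ℕ} (hn : 1 ≤ n) {g : Sp n} (hg : IsSemisimple g) :
    (∃ (a r : Vec n) (l m : ℂ), 0 ≤ l.im ∧ 0 ≤ m.im ∧ 1 < ‖l‖ ∧ herm a a = 0 ∧ herm r r = 0 ∧
      herm a r = 1 ∧ mat g *ᵥ a = MulOpposite.op (l : ℍ) • a ∧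
      mat g *ᵥ r = MulOpposite.op (m : ℍ) • r) ∨
    ∃ (v : Vec n) (l : ℂ), 0 ≤ l.im ∧ herm v v = -1 ∧
      mat g *ᵥ v = MulOpposite.op (l : ℍ) • v := by
  by_cases hA : ∃ (v : Vec n) (l : ℂ), v ≠ 0 ∧ mat g *ᵥ v = MulOpposite.op (l : ℍ) • v ∧ ‖l‖ ≠ 1
  · left
    obtain ⟨v₀, l₀, hv₀, he₀, hl₀⟩ := hA
    -- Eigenvectors span and the form is nondegenerate, so `v₀` pairs with some eigenvector.
    have hw : ∃ (w : Vec n) (m : ℂ), mat g *ᵥ w = MulOpposite.op (m : ℍ) • w ∧ herm v₀ w ≠ 0 := by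
      by_contra! hw
      refine hv₀ (herm_nondegenerate fun u => ?_)
      obtain ⟨s, f, hf, rfl⟩ := hg.exists_sum_eigenvectors u
      rw [herm_sum_right]
      exact Finset.sum_eq_zero fun l _ => hw _ l (hf l)
    obtain ⟨w₀, m₀, hf₀, hvw₀⟩ := hw
    obtain ⟨q, l, hq, hl, hnl, he⟩ := exists_eigenvector_im_nonneg he₀
    obtain ⟨q', m, hq', hm, hnm, hf⟩ := exists_eigenvector_im_nonneg hf₀
    have hvw : herm (MulOpposite.op q • v₀) (MulOpposite.op q' • w₀) ≠ 0 := by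
      rw [herm_smul_left, herm_smul_right]
      have h1 := left_ne_zero_of_mul_eq_one hq'
      have h2 := right_ne_zero_of_mul_eq_one hq
      exact mul_ne_zero (mul_ne_zero h1 hvw₀) h2
    rw [← hnl] at hl₀
    generalize MulOpposite.op q • v₀ = v at he hvw
    generalize MulOpposite.op q' • w₀ = w at hf hvw
    have key : ∀ (v w : Vec n) (l m : ℂ), 0 ≤ l.im → 0 ≤ m.im → 1 < ‖l‖ →
        mat g *ᵥ v = MulOpposite.op (l : ℍ) • v → mat g *ᵥ w = MulOpposite.op (m : ℍ) • w →
        herm v w ≠ 0 → ∃ (a r : Vec n) (l m : ℂ), 0 ≤ l.im ∧ 0 ≤ m.im ∧ 1 < ‖l‖ ∧ herm a a = 0 ∧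
          herm r r = 0 ∧ herm a r = 1 ∧ mat g *ᵥ a = MulOpposite.op (l : ℍ) • a ∧
          mat g *ᵥ r = MulOpposite.op (m : ℍ) • r := by
      intro v w l m hl hm hl1 hv hw hvw
      have hlm := norm_mul_norm_eq_one_of_herm_ne_zero hv hw hvw
      have hvv : herm v v = 0 := by
        by_contra h
        have := norm_mul_norm_eq_one_of_herm_ne_zero hv hv h
        nlinarith
      have hww : herm w w = 0 := by
        by_contra h
        have := norm_mul_norm_eq_one_of_herm_ne_zero hw hw h
        nlinarith [norm_nonneg m]
      have hm0 : star m ≠ 0 := by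
        intro h
        rw [star_eq_zero.1 h] at hlm
        simp at hlm
      -- The eigenvalues `l` and `(conj m)⁻¹` are similar through `⟨v, w⟩` and both lie in the
      -- closed upper half plane, so they agree. Then `⟨v, w⟩` commutes with `l`, and dividing `v`
      -- by it keeps the eigenvalue.
      have hcomm : (((star m)⁻¹ : ℂ) : ℍ) * herm v w = herm v w * (l : ℍ) := by
        have h1 := star_mul_herm_mul_of_eigenvectors hv hw
        rw [star_coeComplex] at h1
        conv_lhs => rw [← h1]
        rw [← mul_assoc, ← mul_assoc, ← Quaternion.coeComplex_mul, inv_mul_cancel₀ hm0]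
        simp
      have hml : (star m)⁻¹ = l := by
        refine coeComplex_eq_of_im_nonneg ?_ hl hvw hcomm
        rw [Complex.inv_im]
        simp only [Complex.star_def, Complex.conj_im, neg_neg]
        exact div_nonneg hm (Complex.normSq_nonneg _)
      rw [hml] at hcomm
      refine ⟨MulOpposite.op (herm v w)⁻¹ • v, w, l, m, hl, hm, hl1, ?_, hww, ?_,
        mulVec_op_smul hv ?_, hw⟩
      · rw [herm_smul_left, herm_smul_right, hvv, mul_zero, zero_mul]
      · rw [herm_smul_left, mul_inv_cancel₀ hvw]
      · exact (Commute.inv_right₀ (show Commute (l : ℍ) (herm v w) from hcomm)).eq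
    rcases lt_or_gt_of_ne hl₀ with h1 | h1
    · refine key w v m l hm hl ?_ hf he fun h => hvw (herm_eq_zero_comm h)
      have := norm_mul_norm_eq_one_of_herm_ne_zero he hf hvw
      nlinarith [norm_nonneg l, norm_nonneg m]
    · exact key v w l m hl hm h1 he hf hvw
  · right
    push Not at hA
    -- All moduli are 1, so in an eigenvector expansion of a negative vector the cross terms have
    -- real part zero. Some diagonal term must then be negative.
    have hneg : ∃ (v : Vec n) (l : ℂ), mat g *ᵥ v = MulOpposite.op (l : ℍ) • v ∧
        (herm v v).re < 0 := by
      by_contra! hpos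
      obtain ⟨e, he⟩ := exists_negative_vector hn
      obtain ⟨s, f, hf, rfl⟩ := hg.exists_sum_eigenvectors e
      refine he.not_ge ?_
      rw [herm_sum_left, re_sum]
      refine Finset.sum_nonneg fun l hl => ?_
      rw [herm_sum_right, re_sum, Finset.sum_eq_single l]
      · exact hpos _ l (hf l)
      · intro m _ hml
        by_cases h0 : f m = 0
        · simp [h0]
        · exact re_herm_eq_zero_of_eigenvectors (hf l) (hf m) (hA _ m h0 (hf m)) hml.symm
      · exact fun h => absurd hl h
    obtain ⟨v, l, hv, hvv⟩ := hneg
    obtain ⟨q, m, hm, -, he, hh⟩ := exists_unit_eigenvector hv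
    refine ⟨_, m, hm, ?_, he⟩
    rw [hh, abs_of_neg hvv, div_neg, div_self hvv.ne]
    simp

/-! ## Eigenframes -/

lemma isEigenframe_iff {n : ℕ} {k : Kind} {g : Sp n} {l : Fin (n + 1) → ℂ} {E : Mat n} :
    IsEigenframe k g l E ↔ NormalizedEigenvalues k l ∧
      (∀ i j, herm (E.col i) (E.col j) = gram n k j i) ∧
      ∀ j, mat g *ᵥ E.col j = MulOpposite.op (l j : ℍ) • E.col j := by
  refine and_congr Iff.rfl (and_congr ?_ ?_)
  · rw [← Matrix.ext_iff, forall_comm]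
    simp only [conjTranspose_siegel_mul_apply]
  · rw [← Matrix.ext_iff, forall_comm]
    refine forall_congr' fun j => ?_
    rw [funext_iff]
    refine forall_congr' fun i => ?_
    rw [Matrix.mul_diagonal]
    rfl

lemma gram_hyperbolic_succ_apply (m : ℕ) (i j : Fin (m + 2)) :
    gram (m + 1) Kind.hyperbolic i j =
      if Equiv.swap 0 (Fin.last (m + 1)) i = j then 1 else 0 := rfl

lemma gram_elliptic_apply (n : ℕ) (i j : Fin (n + 1)) :
    gram n Kind.elliptic i j = if i = j then if i = 0 then -1 else 1 else 0 := by
  simp [gram, Matrix.diagonal_apply]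

/-- Orthonormal eigenvectors of a positive definite subspace, by increasing argument. -/
lemma exists_sorted_orthonormal_eigenvectors {n : ℕ} (g : Sp n) {d : ℕ}
    (W : Submodule ℍᵐᵒᵖ (Vec n)) (hd : Module.finrank ℍᵐᵒᵖ W = d)
    (hg : ∀ w ∈ W, mat g *ᵥ w ∈ W) (hW : ∀ w ∈ W, w ≠ 0 → 0 < (herm w w).re) :
    ∃ (v : Fin d → Vec n) (l : Fin d → ℂ), (∀ i, v i ∈ W) ∧
      (∀ i j, herm (v i) (v j) = if j = i then 1 else 0) ∧ (∀ i, 0 ≤ (l i).im) ∧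
      (∀ i, mat g *ᵥ v i = MulOpposite.op (l i : ℍ) • v i) ∧
      Monotone fun i => (l i).arg := by
  obtain ⟨v, l, h1, h2, h3, h4⟩ := exists_orthonormal_eigenvectors g d W hd hg hW
  let s := Tuple.sort fun i => (l i).arg
  refine ⟨v ∘ s, l ∘ s, fun i => h1 _, fun i j => ?_, fun i => h3 _, fun i => h4 _,
    Tuple.monotone_sort fun i => (l i).arg⟩
  simp [h2, eq_comm]

/-- A semisimple element has an orthonormal eigenframe. -/
theorem IsSemisimple.exists_isEigenframe {n : ℕ} (hn : 1 ≤ n) {g : Sp n} (hg : IsSemisimple g) :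
    ∃ k l E, IsEigenframe k g l E := by
  have htop : Module.finrank ℍᵐᵒᵖ (⊤ : Submodule ℍᵐᵒᵖ (Vec n)) = n + 1 := by
    rw [finrank_top, finrank_vec]
  rcases hg.hyperbolic_or_elliptic hn with
    ⟨a, r, l, m, hl, hm, hl1, haa, hrr, har, ha, hr⟩ | ⟨v, l, hl, hvv, hv⟩
  · obtain ⟨d, rfl⟩ : ∃ d, n = d + 1 := ⟨n - 1, by omega⟩
    have hra : herm r a = 1 := by rw [← star_herm, har, star_one]
    have ha0 : a ≠ 0 := by rintro rfl; simp at har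
    have hr0 : r ≠ 0 := by rintro rfl; simp at har
    -- The complement of the plane of `a` and `r` is cut out in two steps. Both vectors are null, so
    -- each step uses the other vector as witness; `a` survives the first cut.
    have h1 := finrank_inf_ker_hermFunctional (W := ⊤) (u := r) (v := a) trivial
      (by rw [hra]; exact one_ne_zero)
    have h2 := finrank_inf_ker_hermFunctional
      (W := ⊤ ⊓ LinearMap.ker (hermFunctional a)) (u := a) (v := r)
      ⟨trivial, mem_ker_hermFunctional.2 haa⟩ (by rw [har]; exact one_ne_zero)
    obtain ⟨f, t, hfW, hff, ht, hfe, hmono⟩ := exists_sorted_orthonormal_eigenvectors g (d := d)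
      (⊤ ⊓ LinearMap.ker (hermFunctional a) ⊓ LinearMap.ker (hermFunctional r)) (by omega)
      (fun w hw => ⟨⟨trivial, mulVec_mem_ker_hermFunctional ha0 ha hw.1.2⟩,
        mulVec_mem_ker_hermFunctional hr0 hr hw.2⟩)
      (fun w hw hw0 => by
        have hwa := mem_ker_hermFunctional.1 hw.1.2
        have hwr := mem_ker_hermFunctional.1 hw.2
        -- `a - r` is a negative vector, with `⟨a - r, a - r⟩ = -2`.
        refine herm_self_pos_of_orthogonal (v := a - r) ?_ ?_ hw0
        · simp [herm_sub_left, herm_sub_right, haa, hrr, har, hra]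
        · rw [herm_sub_right, hwa, hwr, sub_zero])
    have hfa : ∀ i, herm (f i) a = 0 := fun i => mem_ker_hermFunctional.1 (hfW i).1.2
    have hfr : ∀ i, herm (f i) r = 0 := fun i => mem_ker_hermFunctional.1 (hfW i).2
    have haf : ∀ i, herm a (f i) = 0 := fun i => herm_eq_zero_comm (hfa i)
    have hrf : ∀ i, herm r (f i) = 0 := fun i => herm_eq_zero_comm (hfr i)
    let c : Fin (d + 2) → Vec (d + 1) := Fin.cons a (Fin.snoc f r : Fin (d + 1) → Vec (d + 1))
    let t' : Fin (d + 2) → ℂ := Fin.cons l (Fin.snoc t m : Fin (d + 1) → ℂ)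
    have hcE : ∀ j, (Matrix.of c)ᵀ.col j = c j := fun j => rfl
    have ind : ∀ {P : Fin (d + 2) → Prop}, P 0 → P (Fin.last (d + 1)) →
        (∀ i : Fin d, P i.castSucc.succ) → ∀ i, P i := by
      intro P h0 h1 h2
      refine Fin.cases h0 fun i => ?_
      exact Fin.lastCases h1 h2 i
    have c0 : c 0 = a := rfl
    have cl : c (Fin.last (d + 1)) = r := by
      rw [← Fin.succ_last]; simp [c]
    have cm : ∀ i : Fin d, c i.castSucc.succ = f i := fun i => by simp [c]
    have t0 : t' 0 = l := rfl
    have tl : t' (Fin.last (d + 1)) = m := by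
      rw [← Fin.succ_last]; simp [t']
    have tm : ∀ i : Fin d, t' i.castSucc.succ = t i := fun i => by simp [t']
    have n0 : ∀ i : Fin d, i.castSucc.succ ≠ 0 := fun i => Fin.succ_ne_zero _
    have nl : ∀ i : Fin d, i.castSucc.succ ≠ Fin.last (d + 1) := fun i => by
      rw [← Fin.succ_last]
      exact fun h => (Fin.castSucc_lt_last i).ne (Fin.succ_injective _ h)
    have hsw : ∀ i : Fin d, Equiv.swap 0 (Fin.last (d + 1)) i.castSucc.succ = i.castSucc.succ :=
      fun i => Equiv.swap_apply_of_ne_of_ne (n0 i) (nl i)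
    have h0l : (0 : Fin (d + 2)) ≠ Fin.last (d + 1) := (Fin.last_pos).ne
    refine ⟨Kind.hyperbolic, t', (Matrix.of c)ᵀ, isEigenframe_iff.2 ⟨⟨?_, ?_, ?_⟩, ?_, ?_⟩⟩
    · refine ind ?_ ?_ fun i => ?_
      · exact hl
      · rwa [tl]
      · rw [tm]; exact ht i
    · exact hl1
    · refine ind ?_ ?_ fun i => ?_
      · intro j h; exact absurd h (lt_irrefl _)
      · intro j _ h1 h2; exact absurd h2 (not_lt.2 h1)
      · refine ind ?_ ?_ fun j => ?_
        · intro _ h; exact absurd h (not_le.2 (Fin.succ_pos _))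
        · intro _ _ h; exact absurd h (lt_irrefl _)
        · intro _ h _
          rw [tm, tm]
          exact hmono (Fin.castSucc_le_castSucc_iff.1 (Fin.succ_le_succ_iff.1 h))
    · simp only [hcE, gram_hyperbolic_succ_apply]
      refine ind (ind ?_ ?_ fun j => ?_) (ind ?_ ?_ fun j => ?_)
        fun i => ind ?_ ?_ fun j => ?_ <;>
        simp [c0, cl, cm, haa, hrr, har, hra, hfa, hfr, haf, hrf, hff, hsw, n0, nl, h0l,
          h0l.symm, fun i => (n0 i).symm, fun i => (nl i).symm, -Fin.succ_last]
    · simp only [hcE]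
      refine ind ?_ ?_ fun i => ?_
      · exact ha
      · rw [cl, tl]; exact hr
      · rw [cm, tm]; exact hfe i
  · have hv0 : v ≠ 0 := by rintro rfl; simp at hvv
    have h1 := finrank_inf_ker_hermFunctional (W := ⊤) (u := v) (v := v) trivial
      (by rw [hvv]; simp)
    obtain ⟨f, t, hfW, hff, ht, hfe, hmono⟩ := exists_sorted_orthonormal_eigenvectors g (d := n)
      (⊤ ⊓ LinearMap.ker (hermFunctional v)) (by omega)
      (fun w hw => ⟨trivial, mulVec_mem_ker_hermFunctional hv0 hv hw.2⟩)
      (fun w hw hw0 => herm_self_pos_of_orthogonal (v := v) (by rw [hvv]; simp)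
        (mem_ker_hermFunctional.1 hw.2) hw0)
    have hfv : ∀ i, herm (f i) v = 0 := fun i => mem_ker_hermFunctional.1 (hfW i).2
    have hvf : ∀ i, herm v (f i) = 0 := fun i => herm_eq_zero_comm (hfv i)
    let c : Fin (n + 1) → Vec n := Fin.cons v f
    have hcE : ∀ j, (Matrix.of c)ᵀ.col j = c j := fun j => rfl
    refine ⟨Kind.elliptic, Fin.cons l t, (Matrix.of c)ᵀ, isEigenframe_iff.2 ⟨⟨?_, ?_⟩, ?_, ?_⟩⟩
    · exact Fin.cases hl ht
    · refine Fin.cases ?_ fun i => Fin.cases ?_ fun j => ?_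
      · intro j h; exact absurd h (lt_irrefl _)
      · intro _ h; exact absurd h (not_le.2 (Fin.succ_pos _))
      · intro _ h
        exact hmono (Fin.succ_le_succ_iff.1 h)
    · simp only [hcE, gram_elliptic_apply]
      refine Fin.cases (Fin.cases ?_ fun j => ?_) fun i => Fin.cases ?_ fun j => ?_ <;>
        simp [c, hvv, hfv, hvf, hff, Fin.succ_ne_zero, (Fin.succ_ne_zero _).symm]
    · exact Fin.cases hv hfe

lemma col_mul {n : ℕ} (A P : Mat n) (j : Fin (n + 1)) : (A * P).col j = A *ᵥ P.col j := rfl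

lemma col_mul_diagonal {n : ℕ} (P : Mat n) (d : Fin (n + 1) → ℍ) (j : Fin (n + 1)) :
    (P * Matrix.diagonal d).col j = MulOpposite.op (d j) • P.col j := by
  funext i
  exact Matrix.mul_diagonal d P i j

lemma gram_hyperbolic_apply (n : ℕ) (i j : Fin (n + 1)) :
    gram n Kind.hyperbolic i j = if Equiv.swap 0 (Fin.last n) i = j then 1 else 0 := rfl

lemma zero_ne_last {n : ℕ} (hn : 1 ≤ n) : (0 : Fin (n + 1)) ≠ Fin.last n := by
  intro h
  have := congrArg Fin.val h
  simp at this
  omega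

/-- Columns of `P` need not be eigenvectors with complex eigenvalue any more, but the Gram matrix
survives the frame change. The rigidity argument uses nothing else. -/
lemma InFrameOrbit.conjTranspose_mul_siegel_mul {n : ℕ} {k : Kind} {g : Sp n} {P : Mat n}
    (h : InFrameOrbit k g P) : Pᴴ * siegel n * P = gram n k := by
  obtain ⟨l, E, M, hE, hM, rfl⟩ := h
  rw [← hM.1, ← hE.2.1, Matrix.conjTranspose_mul]
  simp only [Matrix.mul_assoc]

lemma InFrameOrbit.herm_col {n : ℕ} {k : Kind} {g : Sp n} {P : Mat n}
    (h : InFrameOrbit k g P) (i j : Fin (n + 1)) :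
    herm (P.col i) (P.col j) = gram n k j i := by
  rw [← h.conjTranspose_mul_siegel_mul, conjTranspose_siegel_mul_apply]

/-! ## Conjugation -/

lemma IsEigenframe.conj {n : ℕ} {k : Kind} {A : Sp n} {l : Fin (n + 1) → ℂ} {E : Mat n}
    (h : IsEigenframe k A l E) (g : Sp n) : IsEigenframe k (g * A * g⁻¹) l (mat g * E) := by
  refine ⟨h.1, ?_, ?_⟩
  · conv_rhs => rw [← h.2.1, ← QHyp.conjTranspose_mul_siegel_mul g]
    rw [Matrix.conjTranspose_mul]
    simp only [Matrix.mul_assoc]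
  · rw [Matrix.mul_assoc, ← h.2.2, mat_mul, mat_mul, Matrix.mul_assoc, ← Matrix.mul_assoc (mat g⁻¹),
      mat_inv_mul_mat, Matrix.one_mul, Matrix.mul_assoc]

lemma InFrameOrbit.conj {n : ℕ} {k : Kind} {A : Sp n} {P : Mat n}
    (h : InFrameOrbit k A P) (g : Sp n) : InFrameOrbit k (g * A * g⁻¹) (mat g * P) := by
  obtain ⟨l, E, M, hE, hM, rfl⟩ := h
  exact ⟨l, mat g * E, M, hE.conj g, hM, (Matrix.mul_assoc _ _ _).symm⟩

lemma assocVec_mul {n : ℕ} (g : Sp n) (k : Kind) (P : Mat n) (j : Fin (n + 1)) :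
    assocVec k (mat g * P) j = mat g *ᵥ assocVec k P j := by
  cases k
  · simp only [assocVec, col_mul]
    split_ifs
    · rfl
    · rw [Matrix.mulVec_add, Matrix.mulVec_smul, Matrix.mulVec_sub]
  · simp only [assocVec, col_mul]
    split_ifs
    · rfl
    · rw [Matrix.mulVec_add, Matrix.mulVec_smul]

lemma exists_eq_mk_of_submodule_eq {n : ℕ} {p : HP n} {v : Vec n}
    (h : p.submodule = Submodule.span ℍᵐᵒᵖ {v}) :
    ∃ hv : v ≠ 0, p = Projectivization.mk ℍᵐᵒᵖ v hv := by
  have hv : v ≠ 0 := by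
    rintro rfl
    have := p.finrank_submodule
    rw [h, Submodule.span_zero_singleton, finrank_bot] at this
    exact zero_ne_one this
  exact ⟨hv, Projectivization.submodule_injective (by rw [h, Projectivization.submodule_mk])⟩

lemma submodule_smul {n : ℕ} (g : Sp n) {p : HP n} {v : Vec n}
    (h : p.submodule = Submodule.span ℍᵐᵒᵖ {v}) :
    (g • p).submodule = Submodule.span ℍᵐᵒᵖ {mat g *ᵥ v} := by
  obtain ⟨hv, rfl⟩ := exists_eq_mk_of_submodule_eq h
  exact Projectivization.submodule_mk _ ((smul_ne_zero_iff_ne g).2 hv)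

lemma isNonpositive_of_submodule_eq {n : ℕ} {p : HP n} {v : Vec n}
    (h : p.submodule = Submodule.span ℍᵐᵒᵖ {v}) (hv : (herm v v).re ≤ 0) : IsNonpositive p := by
  have hp : p.rep ∈ Submodule.span ℍᵐᵒᵖ {v} := by
    rw [← h, Projectivization.submodule_eq]
    exact Submodule.mem_span_singleton_self _
  obtain ⟨q, hq⟩ := Submodule.mem_span_singleton.1 hp
  rw [IsNonpositive, ← hq, ← MulOpposite.op_unop q, herm_smul_left, herm_smul_right,
    herm_self_eq_coe v, star_mul_coe_mul, Quaternion.re_coe]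
  exact mul_nonpos_of_nonpos_of_nonneg hv Quaternion.normSq_nonneg

/-- The action of `Sp(n,1)` on the closure of hyperbolic space. -/
def moveClosed {n : ℕ} (g : Sp n) (p : ClosedHyp n) : ClosedHyp n :=
  ⟨g • p.1, isNonpositive_of_submodule_eq (submodule_smul g (Projectivization.submodule_eq p.1))
    (by rw [herm_mulVec]; exact p.2)⟩

lemma IsAssociated.conj {n : ℕ} {A B : Sp n} {p : Fin (n + 1) ⊕ Fin (n + 1) → ClosedHyp n}
    (h : IsAssociated A B p) (g : Sp n) :
    IsAssociated (g * A * g⁻¹) (g * B * g⁻¹) fun i => moveClosed g (p i) := by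
  obtain ⟨k, k', P, Q, hP, hQ, hPQ, h1, h2⟩ := h
  refine ⟨k, k', mat g * P, mat g * Q, hP.conj g, hQ.conj g, ?_, fun j => ?_, fun j => ?_⟩
  · simpa only [NormalizedPair, col_mul, herm_mulVec] using hPQ
  · rw [assocVec_mul]
    exact submodule_smul g (h1 j)
  · rw [assocVec_mul]
    exact submodule_smul g (h2 j)

lemma conj_inv_conj {n : ℕ} (g A : Sp n) : g⁻¹ * (g * A * g⁻¹) * g⁻¹⁻¹ = A := by group

lemma canonicalOrbit_subset_conj {n : ℕ} (A B g : Sp n) :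
    canonicalOrbit A B ⊆ canonicalOrbit (g * A * g⁻¹) (g * B * g⁻¹) := by
  rintro c ⟨p, hp, rfl⟩
  exact ⟨_, hp.conj g, Quotient.sound ⟨g⁻¹, fun i => inv_smul_smul g (p i).1⟩⟩

lemma canonicalOrbit_conj {n : ℕ} (A B g : Sp n) :
    canonicalOrbit (g * A * g⁻¹) (g * B * g⁻¹) = canonicalOrbit A B := by
  refine Set.Subset.antisymm ?_ (canonicalOrbit_subset_conj A B g)
  have := canonicalOrbit_subset_conj (g * A * g⁻¹) (g * B * g⁻¹) g⁻¹
  rwa [conj_inv_conj, conj_inv_conj] at this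

lemma mulVec_conj {n : ℕ} (A g : Sp n) (v : Vec n) :
    mat (g * A * g⁻¹) *ᵥ (mat g *ᵥ v) = mat g *ᵥ (mat A *ᵥ v) := by
  rw [Matrix.mulVec_mulVec, ← mat_mul, Matrix.mulVec_mulVec, ← mat_mul, inv_mul_cancel_right]

lemma mulVec_conj_eq {n : ℕ} {A : Sp n} {v : Vec n} {q : ℍ} (g : Sp n)
    (h : mat A *ᵥ v = MulOpposite.op q • v) :
    mat (g * A * g⁻¹) *ᵥ (mat g *ᵥ v) = MulOpposite.op q • mat g *ᵥ v := by
  rw [mulVec_conj, h, Matrix.mulVec_smul]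

lemma negativeClasses_subset_conj {n : ℕ} (A g : Sp n) :
    negativeClasses A ⊆ negativeClasses (g * A * g⁻¹) := by
  rintro l ⟨hl, v, hv, h⟩
  exact ⟨hl, mat g *ᵥ v, by rwa [herm_mulVec], mulVec_conj_eq g h⟩

lemma negativeClasses_conj {n : ℕ} (A g : Sp n) :
    negativeClasses (g * A * g⁻¹) = negativeClasses A := by
  refine Set.Subset.antisymm ?_ (negativeClasses_subset_conj A g)
  have := negativeClasses_subset_conj (g * A * g⁻¹) g⁻¹
  rwa [conj_inv_conj] at this

lemma realTrace_conj {n : ℕ} (A g : Sp n) : realTrace (g * A * g⁻¹) = realTrace A := by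
  rw [realTrace_eq_iff]
  refine charpoly_complexRep_eq (E := mat g) (F := mat g⁻¹) ?_ (mat_inv_mul_mat g)
  rw [← mat_mul, ← mat_mul, inv_mul_cancel_right]

lemma carries_conj {n : ℕ} (A g : Sp n) {l : ℂ} (hl : l.im ≠ 0) :
    Carries g (eigenPoint (mat A) l hl) (eigenPoint (mat (g * A * g⁻¹)) l hl) := by
  refine SetLike.ext fun v => ⟨?_, fun hv => ?_⟩
  · rintro ⟨w, hw, rfl⟩
    exact mulVec_conj_eq g hw
  · refine ⟨mat g⁻¹ *ᵥ v, ?_, ?_⟩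
    · have := mulVec_conj_eq g⁻¹ hv
      rw [conj_inv_conj] at this
      exact this
    · change mat g *ᵥ (mat g⁻¹ *ᵥ v) = v
      rw [Matrix.mulVec_mulVec, mat_mul_mat_inv, Matrix.one_mulVec]

/-! ## Associated points -/

lemma inv_sqrt_two_sq : (Real.sqrt 2)⁻¹ * (Real.sqrt 2)⁻¹ = 1 / 2 := by
  rw [← mul_inv, Real.mul_self_sqrt (by norm_num)]
  norm_num

/-- `(a - r)/√2` has norm `-1`, which cancels the norm of `x_j`, so these points are ideal. The
nonzero real pairings with `a` and `r` are what later compares scalars. -/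
lemma herm_assocVec_hyperbolic {n : ℕ} (hn : 1 ≤ n) {g : Sp n} {P : Mat n}
    (h : InFrameOrbit Kind.hyperbolic g P) {j : Fin (n + 1)} (h0 : j ≠ 0) (hl : j ≠ Fin.last n) :
    herm (assocVec Kind.hyperbolic P j) (P.col 0) = ((-(Real.sqrt 2)⁻¹ : ℝ) : ℍ) ∧
    herm (assocVec Kind.hyperbolic P j) (P.col (Fin.last n)) = (((Real.sqrt 2)⁻¹ : ℝ) : ℍ) ∧
    herm (assocVec Kind.hyperbolic P j) (assocVec Kind.hyperbolic P j) = 0 := by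
  have h0l := zero_ne_last hn
  have hsw : Equiv.swap 0 (Fin.last n) j = j := Equiv.swap_apply_of_ne_of_ne h0 hl
  have hs := inv_sqrt_two_sq
  refine ⟨?_, ?_, ?_⟩ <;>
    simp only [assocVec, h0, hl, or_self, if_false, herm_add_left, herm_add_right,
      herm_real_smul_left, herm_real_smul_right, herm_sub_left, herm_sub_right, h.herm_col,
      gram_hyperbolic_apply, Equiv.swap_apply_left, Equiv.swap_apply_right, hsw, h0l, h0l.symm,
      h0.symm, hl.symm, if_true] <;>
    generalize (Real.sqrt 2)⁻¹ = t at hs ⊢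
  · ext <;> simp
  · ext <;> simp
  · ext <;> simp
    linarith

/-- Here the norm is `-2 + 1`, so the points are interior, and they pair with `x₁` in a nonzero real
number. -/
lemma herm_assocVec_elliptic {n : ℕ} {g : Sp n} {P : Mat n}
    (h : InFrameOrbit Kind.elliptic g P) {j : Fin (n + 1)} (h0 : j ≠ 0) :
    herm (assocVec Kind.elliptic P j) (P.col 0) = ((-(Real.sqrt 2) : ℝ) : ℍ) ∧
    herm (assocVec Kind.elliptic P j) (assocVec Kind.elliptic P j) = -1 := by
  have hs : Real.sqrt 2 * Real.sqrt 2 = 2 := Real.mul_self_sqrt (by norm_num)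
  refine ⟨?_, ?_⟩ <;>
    simp only [assocVec, h0, if_false, herm_add_left, herm_add_right,
      herm_real_smul_left, herm_real_smul_right, h.herm_col,
      gram_elliptic_apply, h0.symm, if_true]
  · ext <;> simp
  · ext <;> simp
    linarith

lemma assocVec_ne_zero_and_nonpos {n : ℕ} (hn : 1 ≤ n) {k : Kind} {g : Sp n} {P : Mat n}
    (h : InFrameOrbit k g P) (j : Fin (n + 1)) :
    assocVec k P j ≠ 0 ∧ (herm (assocVec k P j) (assocVec k P j)).re ≤ 0 := by
  have h2 : Real.sqrt 2 ≠ 0 := by simp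
  have h0l := zero_ne_last hn
  cases k
  · by_cases hj : j = 0 ∨ j = Fin.last n
    · have hv : assocVec Kind.hyperbolic P j = P.col j := by simp [assocVec, hj]
      rw [hv]
      constructor
      · intro h3
        have := h.herm_col j (Equiv.swap 0 (Fin.last n) j)
        rw [h3] at this
        simp [gram_hyperbolic_apply] at this
      · rw [h.herm_col, gram_hyperbolic_apply]
        rcases hj with rfl | rfl <;> simp [h0l, h0l.symm]
    · push Not at hj
      obtain ⟨e1, -, e3⟩ := herm_assocVec_hyperbolic hn h hj.1 hj.2
      have h2' := inv_ne_zero h2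
      generalize (Real.sqrt 2)⁻¹ = t at e1 h2'
      refine ⟨fun h3 => ?_, by rw [e3]; simp⟩
      rw [h3, herm_zero_left] at e1
      have := congrArg QuaternionAlgebra.re e1
      simp [h2'] at this
  · by_cases hj : j = 0
    · subst hj
      have hv : assocVec Kind.elliptic P 0 = P.col 0 := by simp [assocVec]
      rw [hv]
      have := h.herm_col 0 0
      simp only [gram_elliptic_apply, if_true] at this
      refine ⟨fun h3 => ?_, by rw [this]; simp⟩
      rw [h3] at this
      simp at this
    · obtain ⟨e1, e3⟩ := herm_assocVec_elliptic h hj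
      refine ⟨fun h3 => ?_, by rw [e3]; simp⟩
      rw [h3, herm_zero_left] at e1
      have := congrArg QuaternionAlgebra.re e1
      simp at this

/-- The associated points of a frame. -/
lemma exists_assocPoints {n : ℕ} (hn : 1 ≤ n) {k : Kind} {g : Sp n} {P : Mat n}
    (h : InFrameOrbit k g P) : ∃ p : Fin (n + 1) → ClosedHyp n,
      ∀ j, (p j).1.submodule = Submodule.span ℍᵐᵒᵖ {assocVec k P j} :=
  ⟨fun j => ⟨Projectivization.mk ℍᵐᵒᵖ _ (assocVec_ne_zero_and_nonpos hn h j).1,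
    isNonpositive_of_submodule_eq (Projectivization.submodule_mk _ _)
      (assocVec_ne_zero_and_nonpos hn h j).2⟩, fun _ => Projectivization.submodule_mk _ _⟩

lemma isFrameChange_one {n : ℕ} (k : Kind) (l : Fin (n + 1) → ℂ) : IsFrameChange k l 1 :=
  ⟨by simp, fun i j h => Matrix.one_apply_ne fun hij => h (by rw [hij])⟩

/-- The `ℍ*` factor of the frame group: `a` and `r` are scaled inversely so that `⟨a, r⟩ = 1`
persists. It serves to achieve the relative normalization of two frames. -/
lemma isFrameChange_diagonal {n : ℕ} (hn : 1 ≤ n) (l : Fin (n + 1) → ℂ) {q : ℍ} (hq : q ≠ 0) :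
    IsFrameChange Kind.hyperbolic l (Matrix.diagonal fun i =>
      if i = 0 then star q⁻¹ else if i = Fin.last n then q else 1) := by
  have h0l := zero_ne_last hn
  refine ⟨?_, fun i j h => Matrix.diagonal_apply_ne _ fun hij => h (by rw [hij])⟩
  ext1 i j
  rw [Matrix.diagonal_conjTranspose, Matrix.mul_diagonal, Matrix.diagonal_mul,
    gram_hyperbolic_apply]
  by_cases hij : Equiv.swap 0 (Fin.last n) i = j
  · subst hij
    rcases eq_or_ne i 0 with rfl | hi
    · simp [h0l.symm, hq]
    rcases eq_or_ne i (Fin.last n) with rfl | hi'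
    · simp [hi, hq]
    · simp [Equiv.swap_apply_of_ne_of_ne hi hi', hi, hi']
  · simp [hij]

lemma exists_isAssociated {n : ℕ} (hn : 1 ≤ n) {A B : Sp n} (hA : IsSemisimple A)
    (hB : IsSemisimple B) : ∃ p, IsAssociated A B p := by
  obtain ⟨k, l, E, hE⟩ := hA.exists_isEigenframe hn
  obtain ⟨k', l', F, hF⟩ := hB.exists_isEigenframe hn
  have hP : InFrameOrbit k A E := ⟨l, E, 1, hE, isFrameChange_one k l, (Matrix.mul_one E).symm⟩
  have hQ : ∃ Q, InFrameOrbit k' B Q ∧ NormalizedPair k k' E Q := by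
    -- Rescaling only the frame of `B` suffices. The kind of `A` is not consulted, since rescaling
    -- does no harm when no normalization is demanded.
    by_cases h : k' = Kind.hyperbolic ∧ herm (E.col (Fin.last n)) (F.col 0) ≠ 0
    · obtain ⟨rfl, h⟩ := h
      refine ⟨_, ⟨l', F, _, hF, isFrameChange_diagonal hn l' h, rfl⟩, fun _ _ _ => ?_⟩
      rw [col_mul_diagonal, if_pos rfl, herm_smul_right, star_star, inv_mul_cancel₀ h]
    · push Not at h
      exact ⟨F, ⟨l', F, 1, hF, isFrameChange_one k' l', (Matrix.mul_one F).symm⟩,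
        fun _ hk' hne => absurd (h hk') hne⟩
  obtain ⟨Q, hQ, hPQ⟩ := hQ
  obtain ⟨p, hp⟩ := exists_assocPoints hn hP
  obtain ⟨q, hq⟩ := exists_assocPoints hn hQ
  exact ⟨Sum.elim p q, k, k', E, Q, hP, hQ, hPQ, hp, hq⟩

/-- The conjugating element is itself the required `C`; semisimplicity enters to provide one tuple
for it to carry. -/
lemma sameGrassmannianPoints_conj {n : ℕ} (hn : 1 ≤ n) {A B : Sp n} (hA : IsSemisimple A)
    (hB : IsSemisimple B) (g : Sp n) :
    SameGrassmannianPoints A B (g * A * g⁻¹) (g * B * g⁻¹) := by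
  obtain ⟨p, hp⟩ := exists_isAssociated hn hA hB
  exact ⟨g, ⟨p, _, hp, hp.conj g, fun _ => rfl⟩,
    fun l hl => ⟨carries_conj A g hl.ne', carries_conj B g hl.ne'⟩⟩

/-! ## The list of eigenvalues -/

lemma IsEigenframe.star_mul_gram_mul {n : ℕ} {k : Kind} {g : Sp n} {l : Fin (n + 1) → ℂ}
    {E : Mat n} (h : IsEigenframe k g l E) (i j : Fin (n + 1)) :
    star (l i : ℍ) * gram n k i j * (l j : ℍ) = gram n k i j := by
  obtain ⟨-, h2, h3⟩ := isEigenframe_iff.1 h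
  have := star_mul_herm_mul_of_eigenvectors (h3 j) (h3 i)
  rwa [h2] at this

lemma norm_eq_one_of_star_mul_self {z : ℂ} (h : star (z : ℍ) * (z : ℍ) = 1) : ‖z‖ = 1 := by
  have := congrArg norm h
  rw [norm_mul, norm_star, norm_coeComplex, norm_one] at this
  nlinarith [norm_nonneg z]

lemma IsEigenframe.norm_elliptic {n : ℕ} {g : Sp n} {l : Fin (n + 1) → ℂ}
    {E : Mat n} (h : IsEigenframe Kind.elliptic g l E) (i : Fin (n + 1)) : ‖l i‖ = 1 := by
  have := h.star_mul_gram_mul i i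
  rw [gram_elliptic_apply, if_pos rfl] at this
  apply norm_eq_one_of_star_mul_self
  split_ifs at this
  · simpa using this
  · simpa using this

lemma IsEigenframe.norm_hyperbolic {n : ℕ} {g : Sp n} {l : Fin (n + 1) → ℂ}
    {E : Mat n} (h : IsEigenframe Kind.hyperbolic g l E) {i : Fin (n + 1)} (h0 : i ≠ 0)
    (hl : i ≠ Fin.last n) : ‖l i‖ = 1 := by
  have := h.star_mul_gram_mul i i
  rw [gram_hyperbolic_apply, Equiv.swap_apply_of_ne_of_ne h0 hl, if_pos rfl, mul_one] at this
  exact norm_eq_one_of_star_mul_self this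

lemma IsEigenframe.star_last_mul {n : ℕ} {g : Sp n} {l : Fin (n + 1) → ℂ}
    {E : Mat n} (h : IsEigenframe Kind.hyperbolic g l E) :
    star (l (Fin.last n)) * l 0 = 1 := by
  have := h.star_mul_gram_mul (Fin.last n) 0
  rw [gram_hyperbolic_apply, Equiv.swap_apply_right, if_pos rfl, mul_one, star_coeComplex,
    ← Quaternion.coeComplex_mul] at this
  exact congrArg complexPart this

/-- Both Gram matrices are involutions, so the Gram relation itself displays the inverse. -/
lemma exists_inverse_of_conjTranspose_mul_siegel_mul {n : ℕ} {k : Kind} {P : Mat n}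
    (h : Pᴴ * siegel n * P = gram n k) : ∃ F : Mat n, F * P = 1 ∧ P * F = 1 := by
  have hg : gram n k * gram n k = 1 := by
    cases k
    · ext1 i j
      rw [Matrix.mul_apply, Finset.sum_eq_single (Equiv.swap 0 (Fin.last n) i)]
      · simp [gram_hyperbolic_apply, Matrix.one_apply]
      · intro b _ hb
        rw [gram_hyperbolic_apply, if_neg hb.symm, zero_mul]
      · simp
    · rw [gram, Matrix.diagonal_mul_diagonal, ← Matrix.diagonal_one]
      congr 1
      funext j
      split_ifs <;> simp
  have h1 : gram n k * Pᴴ * siegel n * P = 1 := by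
    rw [← hg, ← h]
    simp only [Matrix.mul_assoc]
  exact ⟨_, h1, mul_eq_one_comm.1 h1⟩

lemma IsEigenframe.charpoly {n : ℕ} {k : Kind} {g : Sp n} {l : Fin (n + 1) → ℂ}
    {E : Mat n} (h : IsEigenframe k g l E) : (complexRep (mat g)).charpoly =
      (∏ j, (Polynomial.X - Polynomial.C (l j))) *
        ∏ j, (Polynomial.X - Polynomial.C (star (l j))) := by
  rw [← charpoly_complexRep_diagonal]
  obtain ⟨F, hF, -⟩ := exists_inverse_of_conjTranspose_mul_siegel_mul h.2.1
  exact charpoly_complexRep_eq h.2.2 hF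

/-- Compare root multiplicities: a root above the real axis comes only from the first product, and a
real root is counted once in each, hence twice. -/
lemma map_eq_of_prod_eq {n : ℕ} {l l' : Fin (n + 1) → ℂ} (hl : ∀ j, 0 ≤ (l j).im)
    (hl' : ∀ j, 0 ≤ (l' j).im)
    (h : (∏ j, (Polynomial.X - Polynomial.C (l j))) *
        ∏ j, (Polynomial.X - Polynomial.C (star (l j))) =
      (∏ j, (Polynomial.X - Polynomial.C (l' j))) *
        ∏ j, (Polynomial.X - Polynomial.C (star (l' j)))) :
    Finset.univ.val.map l = Finset.univ.val.map l' := by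
  have hr : ∀ f : Fin (n + 1) → ℂ, ((∏ j, (Polynomial.X - Polynomial.C (f j))) *
        ∏ j, (Polynomial.X - Polynomial.C (star (f j)))).roots =
      Finset.univ.val.map f + (Finset.univ.val.map f).map star := by
    intro f
    have h1 : ∀ f : Fin (n + 1) → ℂ, (∏ j, (Polynomial.X - Polynomial.C (f j))) =
        ((Finset.univ.val.map f).map fun a => Polynomial.X - Polynomial.C a).prod := by
      intro f
      rw [Multiset.map_map]
      rfl
    have h2 : (Finset.univ.val.map f).map star = Finset.univ.val.map fun j => star (f j) := by
      rw [Multiset.map_map]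
      rfl
    rw [Polynomial.roots_mul, h1 f, h1 fun j => star (f j), Polynomial.roots_multiset_prod_X_sub_C,
      Polynomial.roots_multiset_prod_X_sub_C, h2]
    exact mul_ne_zero (Finset.prod_ne_zero_iff.2 fun _ _ => Polynomial.X_sub_C_ne_zero _)
      (Finset.prod_ne_zero_iff.2 fun _ _ => Polynomial.X_sub_C_ne_zero _)
  have h1 := congrArg Polynomial.roots h
  rw [hr, hr] at h1
  have hc : ∀ (f : Fin (n + 1) → ℂ) (z : ℂ),
      ((Finset.univ.val.map f).map star).count z = (Finset.univ.val.map f).count (star z) := by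
    intro f z
    conv_lhs => rw [← star_star z]
    exact Multiset.count_map_eq_count' _ _ star_injective _
  have hneg : ∀ (f : Fin (n + 1) → ℂ), (∀ j, 0 ≤ (f j).im) → ∀ z : ℂ, z.im < 0 →
      (Finset.univ.val.map f).count z = 0 := by
    intro f hf z hz
    rw [Multiset.count_eq_zero]
    intro hmem
    obtain ⟨j, -, rfl⟩ := Multiset.mem_map.1 hmem
    exact absurd (hf j) (not_le.2 hz)
  ext z
  have h2 := congrArg (Multiset.count z) h1
  rw [Multiset.count_add, Multiset.count_add, hc, hc] at h2
  rcases lt_trichotomy z.im 0 with hz | hz | hz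
  · rw [hneg l hl z hz, hneg l' hl' z hz]
  · have : star z = z := Complex.conj_eq_iff_im.2 hz
    rw [this] at h2
    omega
  · have hz' : (star z).im < 0 := by simpa using hz
    rw [hneg l hl _ hz', hneg l' hl' _ hz'] at h2
    omega

/-- On the unit circle the argument is injective, so sorting by it leaves no freedom. -/
lemma eq_of_map_eq_of_monotone_arg {d : ℕ} {f f' : Fin d → ℂ}
    (h : Finset.univ.val.map f = Finset.univ.val.map f') (hf : ∀ i, ‖f i‖ = 1)
    (hf' : ∀ i, ‖f' i‖ = 1) (hm : Monotone fun i => (f i).arg)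
    (hm' : Monotone fun i => (f' i).arg) : f = f' := by
  have hu : ∀ f : Fin d → ℂ, Finset.univ.val.map f = (List.ofFn f : Multiset ℂ) := by
    intro f
    rw [Fin.univ_val_map]
  rw [hu, hu, Multiset.coe_eq_coe] at h
  apply List.ofFn_injective
  refine h.eq_of_pairwise (le := fun z w => z.arg ≤ w.arg) ?_ ?_ ?_
  · intro z w hz hw h1 h2
    obtain ⟨i, rfl⟩ := (List.mem_ofFn' _ _).1 hz
    obtain ⟨j, rfl⟩ := (List.mem_ofFn' _ _).1 hw
    exact Complex.ext_norm_arg ((hf i).trans (hf' j).symm) (le_antisymm h1 h2)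
  · rw [List.pairwise_ofFn]
    exact fun i j hij => hm hij.le
  · rw [List.pairwise_ofFn]
    exact fun i j hij => hm' hij.le

/-- The eigenvalue at the negative vector of an eigenframe of an elliptic element is its only
negative class. -/
lemma IsEigenframe.negativeClasses_elliptic {n : ℕ} {g : Sp n} {l : Fin (n + 1) → ℂ}
    {E : Mat n} (h : IsEigenframe Kind.elliptic g l E) : negativeClasses g = {l 0} := by
  obtain ⟨h1, h2, h3⟩ := isEigenframe_iff.1 h
  ext z
  constructor
  · rintro ⟨hz, v, hv, hgv⟩
    -- Two negative vectors are never orthogonal, and eigenvectors that pair nontrivially have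
    -- similar eigenvalues here because `l 0` is a unit.
    have hne : herm v (E.col 0) ≠ 0 := by
      intro h0
      have hv0 : v ≠ 0 := by rintro rfl; simp at hv
      have := herm_self_pos_of_orthogonal (v := E.col 0)
        (by rw [h2, gram_elliptic_apply]; simp) h0 hv0
      exact lt_asymm hv this
    have key := star_mul_herm_mul_of_eigenvectors hgv (h3 0)
    have hn := h.star_mul_gram_mul 0 0
    rw [gram_elliptic_apply, if_pos rfl, if_pos rfl] at hn
    have hn' : (l 0 : ℍ) * star (l 0 : ℍ) = 1 := by
      rw [mul_eq_one_comm]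
      simpa using hn
    refine (coeComplex_eq_of_im_nonneg (h1.1 0) hz hne ?_).symm
    conv_lhs => rw [← key]
    rw [← mul_assoc, ← mul_assoc, hn', one_mul]
  · rintro rfl
    exact ⟨h1.1 0, E.col 0, by rw [h2, gram_elliptic_apply]; simp, h3 0⟩

/-- The kind, the real trace and the negative classes determine the list of eigenvalues. -/
lemma IsEigenframe.eigenvalues_eq {n : ℕ} (hn : 1 ≤ n) {k : Kind} {g g' : Sp n}
    {l l' : Fin (n + 1) → ℂ} {E E' : Mat n} (h : IsEigenframe k g l E)
    (h' : IsEigenframe k g' l' E') (ht : realTrace g = realTrace g')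
    (hc : negativeClasses g = negativeClasses g') : l = l' := by
  rw [realTrace_eq_iff, h.charpoly, h'.charpoly] at ht
  have hm := map_eq_of_prod_eq h.1.1 h'.1.1 ht
  cases k
  · obtain ⟨d, rfl⟩ : ∃ d, n = d + 1 := ⟨n - 1, by omega⟩
    have h0l := zero_ne_last hn
    have hlast : ‖l (Fin.last _)‖ < 1 := by
      have := congrArg norm h.star_last_mul
      rw [norm_mul, norm_star, norm_one] at this
      nlinarith [h.1.2.1, norm_nonneg (l (Fin.last (d + 1)))]
    -- The first entry is the only one of modulus greater than 1: the middle entries have modulus 1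
    -- and the last one is smaller.
    have h0 : l 0 = l' 0 := by
      have : l' 0 ∈ Finset.univ.val.map l := by
        rw [hm]
        exact Multiset.mem_map_of_mem _ (Finset.mem_univ_val _)
      obtain ⟨j, -, hj⟩ := Multiset.mem_map.1 this
      have hj1 : 1 < ‖l j‖ := by rw [hj]; exact h'.1.2.1
      by_cases hj0 : j = 0
      · rwa [hj0] at hj
      · exfalso
        by_cases hjl : j = Fin.last _
        · rw [hjl] at hj1
          exact lt_asymm hj1 hlast
        · rw [h.norm_hyperbolic hj0 hjl] at hj1
          exact lt_irrefl _ hj1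
    have hl : l (Fin.last _) = l' (Fin.last _) := by
      apply star_injective
      have h00 : l' 0 ≠ 0 := by
        intro h
        have := h'.1.2.1
        rw [h] at this
        simp at this
        linarith
      apply mul_right_cancel₀ h00
      rw [h'.star_last_mul, ← h0, h.star_last_mul]
    have n0 : ∀ i : Fin d, i.castSucc.succ ≠ 0 := fun i => Fin.succ_ne_zero _
    have nl : ∀ i : Fin d, i.castSucc.succ ≠ Fin.last (d + 1) := fun i => by
      rw [← Fin.succ_last]
      exact fun h => (Fin.castSucc_lt_last i).ne (Fin.succ_injective _ h)
    have hsplit : ∀ f : Fin (d + 2) → ℂ, Finset.univ.val.map f =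
        f 0 ::ₘ f (Fin.last _) ::ₘ Finset.univ.val.map fun i : Fin d => f i.castSucc.succ := by
      intro f
      rw [Fin.univ_val_map, Fin.univ_val_map, List.ofFn_succ, List.ofFn_succ', Fin.succ_last,
        List.concat_eq_append, ← Multiset.cons_coe, Multiset.cons_coe (f (Fin.last _))]
      exact congrArg _ (Multiset.coe_eq_coe.2 (List.perm_append_singleton _ _))
    rw [hsplit, hsplit, h0, hl, Multiset.cons_inj_right, Multiset.cons_inj_right] at hm
    have hmid := eq_of_map_eq_of_monotone_arg hm (fun i => h.norm_hyperbolic (n0 i) (nl i))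
      (fun i => h'.norm_hyperbolic (n0 i) (nl i))
      (fun i j hij => h.1.2.2 _ _ (Fin.succ_pos _)
        (Fin.succ_le_succ_iff.2 (Fin.castSucc_le_castSucc_iff.2 hij))
        (lt_of_le_of_ne (Fin.le_last _) (nl j)))
      (fun i j hij => h'.1.2.2 _ _ (Fin.succ_pos _)
        (Fin.succ_le_succ_iff.2 (Fin.castSucc_le_castSucc_iff.2 hij))
        (lt_of_le_of_ne (Fin.le_last _) (nl j)))
    funext i
    refine Fin.cases h0 (fun i => ?_) i
    exact Fin.lastCases (by rwa [Fin.succ_last]) (fun i => congrFun hmid i) i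
  -- In the elliptic case all moduli are 1, so the multiset cannot single out the entry at the
  -- negative vector; the negative class does.
  · rw [h.negativeClasses_elliptic, h'.negativeClasses_elliptic, Set.singleton_eq_singleton_iff] at hc
    have hsplit : ∀ f : Fin (n + 1) → ℂ, Finset.univ.val.map f =
        f 0 ::ₘ Finset.univ.val.map fun i : Fin n => f i.succ := by
      intro f
      rw [Fin.univ_val_map, Fin.univ_val_map, List.ofFn_succ]
      rfl
    rw [hsplit, hsplit, hc, Multiset.cons_inj_right] at hm
    have hmid := eq_of_map_eq_of_monotone_arg hm (fun i => h.norm_elliptic _)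
      (fun i => h'.norm_elliptic _)
      (fun i j hij => h.1.2 _ _ (Fin.succ_pos _) (Fin.succ_le_succ_iff.2 hij))
      (fun i j hij => h'.1.2 _ _ (Fin.succ_pos _) (Fin.succ_le_succ_iff.2 hij))
    funext i
    exact Fin.cases hc (fun i => congrFun hmid i) i

/-! ## Intertwining -/

lemma col_mul_eq_sum {n : ℕ} (E M : Mat n) (j : Fin (n + 1)) :
    (E * M).col j = ∑ i, MulOpposite.op (M i j) • E.col i := by
  funext k
  change (E * M) k j = _
  rw [Matrix.mul_apply, Finset.sum_apply]
  rfl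

/-- `M` mixes only vectors with equal eigenvalue, but with quaternionic coefficients, so the column
lies in the quaternionic span of the eigenset and not necessarily in the eigenset. -/
lemma IsFrameChange.col_mem {n : ℕ} {k : Kind} {g : Sp n} {l : Fin (n + 1) → ℂ} {E M : Mat n}
    (hE : IsEigenframe k g l E) (hM : IsFrameChange k l M) (j : Fin (n + 1)) :
    (E * M).col j ∈ classEigenspace (mat g) (l j) := by
  rw [col_mul_eq_sum]
  refine Submodule.sum_mem _ fun i _ => ?_
  by_cases h : l i = l j
  · refine Submodule.smul_mem _ _ (Submodule.subset_span ?_)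
    rw [← h]
    exact (isEigenframe_iff.1 hE).2.2 i
  · rw [hM.2 i j h, MulOpposite.op_zero, zero_smul]
    exact Submodule.zero_mem _

/-- A real eigenvalue is central, so quaternionic combinations of its eigenvectors are again
eigenvectors. -/
lemma IsFrameChange.mulVec_col {n : ℕ} {k : Kind} {g : Sp n} {l : Fin (n + 1) → ℂ} {E M : Mat n}
    (hE : IsEigenframe k g l E) (hM : IsFrameChange k l M) {j : Fin (n + 1)}
    (hj : (l j).im = 0) :
    mat g *ᵥ (E * M).col j = MulOpposite.op (((l j).re : ℝ) : ℍ) • (E * M).col j := by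
  have hr : ((l j : ℂ) : ℍ) = (((l j).re : ℝ) : ℍ) := by
    ext <;> simp [hj]
  rw [col_mul_eq_sum, Matrix.mulVec_sum, Finset.smul_sum]
  refine Finset.sum_congr rfl fun i _ => ?_
  by_cases h : l i = l j
  · refine mulVec_op_smul ((isEigenframe_iff.1 hE).2.2 i) ?_
    rw [h, hr, Quaternion.coe_commutes]
  · rw [hM.2 i j h]
    simp

/-- Both sides are quaternion-linear in `v`, so it is enough to check the eigenset, where both
matrices multiply by the same `l`. -/
lemma Carries.mulVec_mulVec {n : ℕ} {A A' C : Sp n} {l : ℂ} {hl : l.im ≠ 0}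
    (h : Carries C (eigenPoint (mat A) l hl) (eigenPoint (mat A') l hl)) {v : Vec n}
    (hv : v ∈ classEigenspace (mat A) l) :
    mat A' *ᵥ (mat C *ᵥ v) = mat C *ᵥ (mat A *ᵥ v) := by
  induction hv using Submodule.span_induction with
  | mem v hv =>
    have h1 : mat C *ᵥ v ∈ (eigenPoint (mat A') l hl).1 := by
      rw [← h]
      exact ⟨v, hv, rfl⟩
    have h2 : mat A' *ᵥ (mat C *ᵥ v) = MulOpposite.op (l : ℍ) • mat C *ᵥ v := h1
    have h3 : mat A *ᵥ v = MulOpposite.op (l : ℍ) • v := hv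
    rw [h2, h3, Matrix.mulVec_smul]
  | zero => simp
  | add u v _ _ hu hv => simp only [Matrix.mulVec_add, hu, hv]
  | smul q v _ hv => simp only [Matrix.mulVec_smul, hv]

lemma mul_eq_one_of_mul_coe_mul {t : ℝ} (ht : t ≠ 0) {a b : ℍ}
    (h : a * (t : ℍ) * b = (t : ℍ)) : a * b = 1 := by
  have ht' : (t : ℍ) ≠ 0 := fun h0 => ht (Quaternion.coe_injective h0)
  apply mul_left_cancel₀ ht'
  rw [← mul_assoc, Quaternion.coe_commutes, h, mul_one]

/-- An element that carries the associated points of a frame to those of a frame carries the lines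
of the frame to those of the frame. -/
lemma exists_smul_col_of_assocVec {n : ℕ} (hn : 1 ≤ n) {k k' : Kind} {A A' C : Sp n} {P P' : Mat n}
    (hP : InFrameOrbit k A P) (hP' : InFrameOrbit k' A' P')
    (h : ∀ j, ∃ q : ℍ, mat C *ᵥ assocVec k P j = MulOpposite.op q • assocVec k' P' j) :
    k = k' ∧ ∀ j, ∃ q : ℍ, mat C *ᵥ P.col j = MulOpposite.op q • P'.col j := by
  have h0l := zero_ne_last hn
  have hs : ((Real.sqrt 2)⁻¹ : ℝ) ≠ 0 := by simp
  have a0 : ∀ k (P : Mat n), assocVec k P 0 = P.col 0 := by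
    intro k P
    cases k <;> simp [assocVec]
  have al : ∀ (P : Mat n), assocVec Kind.hyperbolic P (Fin.last n) = P.col (Fin.last n) := by
    intro P
    simp [assocVec]
  choose q hq using h
  have q0 := hq 0
  rw [a0, a0] at q0
  -- The first frame vector is null or negative according to the kind, so this entry separates the
  -- kinds.
  have e0 : gram n k 0 0 = star (q 0) * gram n k' 0 0 * q 0 := by
    rw [← hP.herm_col, ← hP'.herm_col, ← herm_mulVec C, q0, herm_smul_left, herm_smul_right]
  cases k <;> cases k'
  · refine ⟨rfl, ?_⟩
    have ql := hq (Fin.last n)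
    rw [al, al] at ql
    have e1 : star (q (Fin.last n)) * q 0 = 1 := by
      have := herm_mulVec C (P.col 0) (P.col (Fin.last n))
      rw [q0, ql, herm_smul_left, herm_smul_right, hP.herm_col, hP'.herm_col,
        gram_hyperbolic_apply, Equiv.swap_apply_right, if_pos rfl, mul_one] at this
      exact this
    intro j
    by_cases hj0 : j = 0
    · exact ⟨q 0, hj0 ▸ q0⟩
    by_cases hjl : j = Fin.last n
    · exact ⟨q (Fin.last n), hjl ▸ ql⟩
    obtain ⟨f1, f2, -⟩ := herm_assocVec_hyperbolic hn hP hj0 hjl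
    obtain ⟨f1', f2', -⟩ := herm_assocVec_hyperbolic hn hP' hj0 hjl
    rw [← herm_mulVec C, hq j, q0, herm_smul_left, herm_smul_right, f1'] at f1
    rw [← herm_mulVec C, hq j, ql, herm_smul_left, herm_smul_right, f2'] at f2
    have g1 := mul_eq_one_of_mul_coe_mul (neg_ne_zero.2 hs) f1
    have g2 := mul_eq_one_of_mul_coe_mul hs f2
    -- The three pairings give `conj (q 0) q_j = conj (q_last) q_j = conj (q_last) q_0 = 1`, so all
    -- scalars coincide. The `a`, `r` part can then be subtracted, leaving `x_j`.
    have hj : q j = q 0 := mul_left_cancel₀ (left_ne_zero_of_mul_eq_one g2) (g2.trans e1.symm)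
    have hl : q (Fin.last n) = q 0 := by
      rw [hj] at g1
      apply star_injective
      exact mul_right_cancel₀ (right_ne_zero_of_mul_eq_one g1) (e1.trans g1.symm)
    refine ⟨q 0, ?_⟩
    have := hq j
    rw [hj] at this
    simp only [assocVec, hj0, hjl, or_self, if_false] at this
    rw [Matrix.mulVec_add, Matrix.mulVec_smul, Matrix.mulVec_sub, q0, ql, hl, smul_add,
      ← smul_sub, smul_comm] at this
    exact add_left_cancel this
  · exfalso
    have hq0 : q 0 = 0 := by
      simpa [gram_elliptic_apply, gram_hyperbolic_apply, h0l.symm] using e0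
    have := herm_mulVec C (P.col 0) (P.col (Fin.last n))
    rw [q0, hq0, MulOpposite.op_zero, zero_smul, herm_zero_left, hP.herm_col,
      gram_hyperbolic_apply, Equiv.swap_apply_right, if_pos rfl] at this
    exact zero_ne_one this
  · exfalso
    simp [gram_elliptic_apply, gram_hyperbolic_apply, h0l.symm] at e0
  · refine ⟨rfl, ?_⟩
    intro j
    by_cases hj0 : j = 0
    · exact ⟨q 0, hj0 ▸ q0⟩
    have g0 : star (q 0) * q 0 = 1 := by
      simpa [gram_elliptic_apply] using e0.symm
    obtain ⟨f1, -⟩ := herm_assocVec_elliptic hP hj0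
    obtain ⟨f1', -⟩ := herm_assocVec_elliptic hP' hj0
    rw [← herm_mulVec C, hq j, q0, herm_smul_left, herm_smul_right, f1'] at f1
    have g1 := mul_eq_one_of_mul_coe_mul (neg_ne_zero.2 (by simp)) f1
    have hj : q j = q 0 := mul_left_cancel₀ (left_ne_zero_of_mul_eq_one g1) (g1.trans g0.symm)
    refine ⟨q 0, ?_⟩
    have := hq j
    rw [hj] at this
    simp only [assocVec, hj0, if_false] at this
    rw [Matrix.mulVec_add, Matrix.mulVec_smul, q0, smul_add, smul_comm] at this
    exact add_left_cancel this

lemma exists_smul_of_smul_eq {n : ℕ} {C : Sp n} {p q : HP n} {v w : Vec n}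
    (hp : p.submodule = Submodule.span ℍᵐᵒᵖ {v}) (hq : q.submodule = Submodule.span ℍᵐᵒᵖ {w})
    (h : C • p = q) : ∃ c : ℍ, mat C *ᵥ v = MulOpposite.op c • w := by
  have h1 := submodule_smul C hp
  rw [h, hq] at h1
  have h2 : mat C *ᵥ v ∈ Submodule.span ℍᵐᵒᵖ {w} := by
    rw [h1]
    exact Submodule.mem_span_singleton_self _
  obtain ⟨c, hc⟩ := Submodule.mem_span_singleton.1 h2
  exact ⟨c.unop, by rw [MulOpposite.op_unop, hc]⟩

/-- An element that carries associated points to associated points, and eigensets to eigensets,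
conjugates `A` to `A'`, if these have the same real trace and the same negative classes. -/
lemma conj_eq_of_carries {n : ℕ} (hn : 1 ≤ n) {k k' : Kind} {A A' C : Sp n} {P P' : Mat n}
    (hP : InFrameOrbit k A P) (hP' : InFrameOrbit k' A' P')
    (h : ∀ j, ∃ q : ℍ, mat C *ᵥ assocVec k P j = MulOpposite.op q • assocVec k' P' j)
    (ht : realTrace A = realTrace A') (hc : negativeClasses A = negativeClasses A')
    (hC : ∀ (l : ℂ) (hl : 0 < l.im),
      Carries C (eigenPoint (mat A) l hl.ne') (eigenPoint (mat A') l hl.ne')) :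
    A' = C * A * C⁻¹ := by
  obtain ⟨rfl, hcol⟩ := exists_smul_col_of_assocVec hn hP hP' h
  obtain ⟨F, -, hF⟩ := exists_inverse_of_conjTranspose_mul_siegel_mul hP.conjTranspose_mul_siegel_mul
  obtain ⟨l, E, M, hE, hM, rfl⟩ := hP
  obtain ⟨l', E', M', hE', hM', rfl⟩ := hP'
  obtain rfl := hE.eigenvalues_eq hn hE' ht hc
  have key : mat A' * mat C * (E * M) = mat C * mat A * (E * M) := by
    have : ∀ j, (mat A' * mat C * (E * M)).col j = (mat C * mat A * (E * M)).col j := by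
      intro j
      rw [col_mul (mat A' * mat C), col_mul (mat C * mat A), ← Matrix.mulVec_mulVec,
        ← Matrix.mulVec_mulVec]
      -- For a real eigenvalue, matching lines is enough because the scalar is central. For a
      -- non-real one, the eigenset condition is used.
      rcases (hE.1.1 j).eq_or_lt with hj | hj
      · obtain ⟨q, hq⟩ := hcol j
        rw [hM.mulVec_col hE hj.symm, hq, Matrix.mulVec_smul, Matrix.mulVec_smul,
          hM'.mulVec_col hE' hj.symm, hq, smul_smul, smul_smul, ← MulOpposite.op_mul,
          ← MulOpposite.op_mul, Quaternion.coe_commutes]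
      · exact (hC _ hj).mulVec_mulVec (hM.col_mem hE j)
    ext1 i j
    exact congrFun (this j) i
  -- The columns of the frame form a basis, so the relation on them can be cancelled to one of
  -- matrices.
  have key2 : mat A' * mat C = mat C * mat A := by
    have := congrArg (· * F) key
    simpa only [Matrix.mul_assoc, hF, Matrix.mul_one] using this
  rw [eq_mul_inv_iff_mul_eq]
  exact mat_injective key2

end QHyp

end

/-! ### The classification theorem. -/

theorem mainTheorem2 (n : ℕ) (hn : 1 ≤ n) (ρ σ : QHyp.SSRep n) :
    ρ.toXss = σ.toXss ↔
      QHyp.realTrace (ρ.1 QHyp.x) = QHyp.realTrace (σ.1 QHyp.x) ∧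
      QHyp.realTrace (ρ.1 QHyp.y) = QHyp.realTrace (σ.1 QHyp.y) ∧
      QHyp.negativeClasses (ρ.1 QHyp.x) = QHyp.negativeClasses (σ.1 QHyp.x) ∧
      QHyp.negativeClasses (ρ.1 QHyp.y) = QHyp.negativeClasses (σ.1 QHyp.y) ∧
      QHyp.canonicalOrbit (ρ.1 QHyp.x) (ρ.1 QHyp.y) =
        QHyp.canonicalOrbit (σ.1 QHyp.x) (σ.1 QHyp.y) ∧
      QHyp.SameGrassmannianPoints (ρ.1 QHyp.x) (ρ.1 QHyp.y) (σ.1 QHyp.x) (σ.1 QHyp.y) := by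
  open QHyp in
  constructor
  · intro h
    obtain ⟨g, hg⟩ : ∃ g : Sp n, ∀ w : F₂, σ.1 w = g * ρ.1 w * g⁻¹ := Quotient.exact h
    rw [hg, hg]
    exact ⟨(realTrace_conj _ g).symm, (realTrace_conj _ g).symm, (negativeClasses_conj _ g).symm,
      (negativeClasses_conj _ g).symm, (canonicalOrbit_conj _ _ g).symm,
      sameGrassmannianPoints_conj hn ρ.2.1 ρ.2.2 g⟩
  · rintro ⟨tx, ty, cx, cy, -, C, ⟨p, q, hp, hq, hpq⟩, hC⟩
    obtain ⟨k₁, k₂, P, Q, hP, hQ, -, p1, p2⟩ := hp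
    obtain ⟨k₁', k₂', P', Q', hP', hQ', -, q1, q2⟩ := hq
    have hx := conj_eq_of_carries hn hP hP'
      (fun j => exists_smul_of_smul_eq (p1 j) (q1 j) (hpq (Sum.inl j))) tx cx
      fun l hl => (hC l hl).1
    have hy := conj_eq_of_carries hn hQ hQ'
      (fun j => exists_smul_of_smul_eq (p2 j) (q2 j) (hpq (Sum.inr j))) ty cy
      fun l hl => (hC l hl).2
    refine Quotient.sound ⟨C, fun w => ?_⟩
    have : σ.1 = (MulAut.conj C).toMonoidHom.comp ρ.1 := by
      refine FreeGroup.ext_hom _ _ fun i => ?_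
      fin_cases i
      · exact hx
      · exact hy
    rw [this]
    rfl
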